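/- Let $G$ be a finite simple bipartite graph with vertex set $V$ and edge set $E$, let $\mathbb{k}$ be a field, and let $R=\mathbb{k}[v \mid v\in V]$ be the polynomial ring whose variables are the vertices of $G$. Let $I=I(G)\subset R$ be the edge ideal, generated by the monomials $f_e=uv$ for the edges $e=\{u,v\}\in E$. Let $S=R[T_e \mid e\in E]$ and let $\mathcal{J}$ be the kernel of the $\mathbb{k}$-algebra homomorphism from $S$ to the Rees algebra $\bigoplus_{i\ge 0} I^it^i\subset R[t]$ with $v\mapsto v$ for $v \in V$ and $T_e\mapsto f_e t$ for $e\in E$. For a walk $w=(v_0,\ldots,v_a)$ in $G$ put $$T_{w^+}=\prod_{1\le j\le a,\ j\text{ even}}T_{\{v_{j-1},v_j\}},\qquad T_{w^-}=\prod_{1\le j\le a,\ j\text{ odd}}T_{\{v_{j-1},v_j\}}$$ (empty products are $1$). The universal Gröbner basis $\mathcal{U}$ of $\mathcal{J}$, that is, the union of the reduced Gröbner bases (with leading coefficients $1$) of $\mathcal{J}$ over all monomial orders on $S$, is $$\begin{aligned}\mathcal{U}=\ &\{T_{w^+}-T_{w^-} \mid w=(v_0,\ldots,v_a=v_0)\text{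 is an even cycle in } G\}\\ \cup\ &\{v_0T_{w^+}-v_aT_{w^-} \mid w=(v_0,\ldots,v_a)\text{ is an even path in } G \text{ with } a>0\}\\ \cup\ &\{u_0u_aT_{w_1^+}T_{w_2^-}-v_0v_bT_{w_1^-}T_{w_2^+} \mid w_1=(u_0,\ldots,u_a)\text{ and } w_2=(v_0,\ldots,v_b)\text{ are vertex-disjoint odd paths in } G\}.\end{aligned}$$ Here a path or cycle is even (odd) if its number $a$ of edges is even (odd), a path has no repeated vertices, and all choices of starting point and direction are allowed; each of the three sets therefore contains, with a binomial, also its negative. -/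

import Mathlib

universe u

noncomputable section

namespace BipartiteRees

/-- `B` is a reduced Gröbner basis of the ideal `J` for the monomial order `m`: a finite subset of
`J` whose leading terms generate the initial ideal of `J`, all of whose elements have leading
coefficient `1`, and such that no monomial occurring in an element of `B` is divisible by the
leading monomial of another element of `B`. -/
structure IsReducedGroebnerBasis {σ : Type u} {K : Type*} [Field K] (m : MonomialOrder.{u, u} σ)
    (J : Ideal (MvPolynomial σ K)) (B : Set (MvPolynomial σ K)) : Prop where
  finite : B.Finite
  subset : B ⊆ (J : Set (MvPolynomial σ K))
  span_leadingTerm :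
    Ideal.span (m.leadingTerm '' B) = Ideal.span (m.leadingTerm '' (J : Set (MvPolynomial σ K)))
  monic : ∀ g ∈ B, m.Monic g
  reduced : ∀ g ∈ B, ∀ h ∈ B, h ≠ g → ∀ s ∈ g.support, ¬ m.degree h ≤ s

/-- The universal Gröbner basis of `J`: the union of the reduced Gröbner bases of `J` over all
monomial orders. The synonym type of a monomial order on `σ : Type u` can always be taken to be a
copy of `σ →₀ ℕ`, so that it is no restriction to take it in `Type u`. -/
def universalGroebnerBasis {σ : Type u} {K : Type*} [Field K] (J : Ideal (MvPolynomial σ K)) :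
    Set (MvPolynomial σ K) :=
  {f | ∃ (m : MonomialOrder.{u, u} σ) (B : Set (MvPolynomial σ K)),
    IsReducedGroebnerBasis m J B ∧ f ∈ B}

section Rees

variable (K : Type*) [Field K] {V : Type u} (G : SimpleGraph V)

/-- The monomial `x_a x_b` of the edge `e = {a, b}`. -/
def edgeMonomial (e : G.edgeSet) : MvPolynomial V K :=
  Sym2.mul ((e : Sym2 V).map MvPolynomial.X)

/-- The edge ideal `I(G)` in the polynomial ring on the vertices of `G`. -/
def edgeIdeal : Ideal (MvPolynomial V K) :=
  Ideal.span (Set.range (edgeMonomial K G))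

theorem monomial_edgeMonomial_mem (e : G.edgeSet) :
    Polynomial.monomial 1 (edgeMonomial K G e) ∈ reesAlgebra (edgeIdeal K G) := by
  rw [reesAlgebra.monomial_mem, pow_one]
  exact Ideal.subset_span ⟨e, rfl⟩

/-- The polynomial ring `S` with one variable for each vertex and one variable `T_e` for each
edge `e` of `G`. -/
abbrev ReesRing : Type _ := MvPolynomial (V ⊕ G.edgeSet) K

/-- The presentation `ψ : S → Rees(I(G))`, sending each vertex variable to itself and `T_e` to
`f_e t`, where `f_e` is the monomial of the edge `e`. -/
def reesMap : ReesRing K G →ₐ[K] reesAlgebra (edgeIdeal K G) :=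
  MvPolynomial.aeval (Sum.elim
    (fun v => algebraMap (MvPolynomial V K) (reesAlgebra (edgeIdeal K G)) (MvPolynomial.X v))
    (fun e => ⟨Polynomial.monomial 1 (edgeMonomial K G e), monomial_edgeMonomial_mem K G e⟩))

/-- The defining ideal of the Rees algebra of `I(G)`: the kernel of `ψ`. -/
def reesIdeal : Ideal (ReesRing K G) :=
  RingHom.ker (reesMap K G)

variable {G}

/-- The variable of the vertex `v`. -/
def vertexVar (G : SimpleGraph V) (v : V) : ReesRing K G :=
  MvPolynomial.X (Sum.inl v)

/-- The variable `T` of the edge `{v_i, v_{i+1}}` of the walk `w = (v_0, …, v_a)`, where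
`0 ≤ i < a`; this is the edge number `i + 1` of `w`. -/
def walkEdgeVar {a b : V} (w : G.Walk a b) (i : Fin w.length) : ReesRing K G :=
  MvPolynomial.X (Sum.inr
    ⟨s(w.getVert i, w.getVert ((i : ℕ) + 1)), w.adj_getVert_succ i.isLt⟩)

/-- `T_{w^+}`: the product of the variables of the edges of even number
(the first edge has number 1). -/
def walkPlus {a b : V} (w : G.Walk a b) : ReesRing K G :=
  ∏ i ∈ Finset.univ.filter (fun i : Fin w.length => Even ((i : ℕ) + 1)), walkEdgeVar K w i

/-- `T_{w^-}`: the product of the variables of the edges of odd number. -/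
def walkMinus {a b : V} (w : G.Walk a b) : ReesRing K G :=
  ∏ i ∈ Finset.univ.filter (fun i : Fin w.length => Odd ((i : ℕ) + 1)), walkEdgeVar K w i

/-- `T_w = T_{w^+} - T_{w^-}`, for closed walks `w`. -/
def cycleBinomial {v : V} (w : G.Walk v v) : ReesRing K G :=
  walkPlus K w - walkMinus K w

/-- `v_0 T_{w^+} - v_a T_{w^-}` for `w = (v_0, …, v_a)`. -/
def pathBinomial {v₀ vₐ : V} (w : G.Walk v₀ vₐ) : ReesRing K G :=
  vertexVar K G v₀ * walkPlus K w - vertexVar K G vₐ * walkMinus K w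

/-- `u_0 u_a T_{w₁^+} T_{w₂^-} - v_0 v_b T_{w₁^-} T_{w₂^+}` for `w₁ = (u_0, …, u_a)` and
`w₂ = (v_0, …, v_b)`. -/
def pathPairBinomial {u₀ uₐ v₀ v_b : V} (w₁ : G.Walk u₀ uₐ) (w₂ : G.Walk v₀ v_b) :
    ReesRing K G :=
  vertexVar K G u₀ * vertexVar K G uₐ * (walkPlus K w₁ * walkMinus K w₂) -
    vertexVar K G v₀ * vertexVar K G v_b * (walkMinus K w₁ * walkPlus K w₂)

end Rees

end BipartiteRees

end

/-! The ideal `reesIdeal` is toric: the presentation sends each monomial to a single monomial, and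
two monomials have the same image exactly when `vertexDegree` and `edgeDegree` agree. For a toric
ideal, circuits lie in the universal Gröbner basis, and elements of reduced Gröbner bases are
primitive binomials (the Graver basis). It therefore suffices to show that every primitive binomial
is on the list and that every binomial on the list is a circuit, with coefficients that make it the
generator of the relations on its support.

Primitive implies listed (`hasWalkPairLE_of_ne`): let `a` and `b` be coprime exponents of equal
bidegree. Take a longest path whose edges alternate between `a` and `b`. Equality of vertex degrees
at an end supplies a vertex variable there, or an edge that would continue the alternation; by
maximality that edge closes a cycle, which is even because the graph is bipartite. So one finds a
cycle, an even path, or an odd path with both end variables on the same side. An odd path changes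
the exponent of `t` by one, so removing it leaves an imbalance, which forces an odd path of the
opposite kind. If the two are disjoint they form a pair; if they meet, they splice to an even path.

Listed implies circuit (`IsWalkPair.exists_eq_smul`): along a path, vanishing vertex degrees
determine a relation from its value at one end. A cycle is a path plus an edge, and for a pair the
edge degree ties the two multiples together. An order that eliminates the variables outside the
support, with a suitable largest variable inside, then puts the binomial in a reduced Gröbner basis.
-/

namespace BipartiteRees

open SimpleGraph Finsupp

/-! ### Exponent vectors of walks -/

section Exponents

variable {V : Type u} {G : SimpleGraph V}

/-- The exponent vectors of `T_{w^+}` and `T_{w^-}`. -/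
noncomputable def walkExp : ∀ {u v : V}, G.Walk u v → (V ⊕ G.edgeSet →₀ ℕ) × (V ⊕ G.edgeSet →₀ ℕ)
  | _, _, .nil => (0, 0)
  -- Prepending an edge shifts the numbers of all later edges by one, so the components swap; the
  -- new edge has the odd number 1.
  | u, _, .cons (v := v) h p => ((walkExp p).2, single (Sum.inr ⟨s(u, v), h⟩) 1 + (walkExp p).1)

/-- The exponent vector of `T_{w^+}`. -/
noncomputable def plusExp {u v : V} (w : G.Walk u v) : V ⊕ G.edgeSet →₀ ℕ := (walkExp w).1

/-- The exponent vector of `T_{w^-}`. -/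
noncomputable def minusExp {u v : V} (w : G.Walk u v) : V ⊕ G.edgeSet →₀ ℕ := (walkExp w).2

@[simp] theorem plusExp_nil {u : V} : plusExp (.nil : G.Walk u u) = 0 := rfl

@[simp] theorem minusExp_nil {u : V} : minusExp (.nil : G.Walk u u) = 0 := rfl

@[simp] theorem plusExp_cons {u v x : V} (h : G.Adj u v) (p : G.Walk v x) :
    plusExp (.cons h p) = minusExp p := rfl

@[simp] theorem minusExp_cons {u v x : V} (h : G.Adj u v) (p : G.Walk v x) :
    minusExp (.cons h p) = single (Sum.inr ⟨s(u, v), h⟩) 1 + plusExp p := rfl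

/-- The edges of `q` are renumbered by adding the length of `p`, which swaps their parities exactly
when that length is odd. -/
theorem walkExp_append {u v x : V} (p : G.Walk u v) (q : G.Walk v x) :
    (Even p.length → plusExp (p.append q) = plusExp p + plusExp q ∧
      minusExp (p.append q) = minusExp p + minusExp q) ∧
    (Odd p.length → plusExp (p.append q) = plusExp p + minusExp q ∧
      minusExp (p.append q) = minusExp p + plusExp q) := by
  induction p with
  | nil => simp
  | cons h p ih =>
    simp only [Walk.length_cons, Nat.even_add_one, Nat.odd_add_one, Nat.not_even_iff_odd,
      Nat.not_odd_iff_even, Walk.cons_append, plusExp_cons, minusExp_cons]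
    exact ⟨fun ho => ⟨(ih q).2 ho |>.2, by rw [((ih q).2 ho).1, add_assoc]⟩,
      fun he => ⟨(ih q).1 he |>.2, by rw [((ih q).1 he).1, add_assoc]⟩⟩

theorem plusExp_le_append {u v x : V} (p : G.Walk u v) (q : G.Walk v x) :
    plusExp p ≤ plusExp (p.append q) := by
  rcases Nat.even_or_odd p.length with h | h
  · rw [((walkExp_append p q).1 h).1]; exact le_self_add
  · rw [((walkExp_append p q).2 h).1]; exact le_self_add

theorem minusExp_le_append {u v x : V} (p : G.Walk u v) (q : G.Walk v x) :
    minusExp p ≤ minusExp (p.append q) := by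
  rcases Nat.even_or_odd p.length with h | h
  · rw [((walkExp_append p q).1 h).2]; exact le_self_add
  · rw [((walkExp_append p q).2 h).2]; exact le_self_add

/-- Reversal replaces the number `j` by `length + 1 - j`, which changes parity exactly for even
length. -/
theorem walkExp_reverse {u v : V} (p : G.Walk u v) :
    (Even p.length → plusExp p.reverse = minusExp p ∧ minusExp p.reverse = plusExp p) ∧
    (Odd p.length → plusExp p.reverse = plusExp p ∧ minusExp p.reverse = minusExp p) := by
  induction p with
  | nil => simp
  | @cons u v x h p ih =>
    simp only [Walk.length_cons, Nat.even_add_one, Nat.odd_add_one, Nat.not_even_iff_odd,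
      Nat.not_odd_iff_even, Walk.reverse_cons, plusExp_cons, minusExp_cons]
    have hs : (⟨s(v, u), h.symm⟩ : G.edgeSet) = ⟨s(u, v), h⟩ := Subtype.ext Sym2.eq_swap
    constructor
    · intro ho
      have := (walkExp_append p.reverse (.cons h.symm .nil)).2 (by simpa using ho)
      rw [this.1, this.2, (ih.2 ho).1, (ih.2 ho).2]
      simp [hs, add_comm]
    · intro he
      have := (walkExp_append p.reverse (.cons h.symm .nil)).1 (by simpa using he)
      rw [this.1, this.2, (ih.1 he).1, (ih.1 he).2]
      simp [hs, add_comm]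

@[simp] theorem walkExp_inl {u v : V} (p : G.Walk u v) (x : V) :
    plusExp p (Sum.inl x) = 0 ∧ minusExp p (Sum.inl x) = 0 := by
  induction p with
  | nil => simp
  | cons h p ih => simp [ih]

theorem walkExp_inr [DecidableEq V] {u v : V} (p : G.Walk u v) (e : G.edgeSet) :
    plusExp p (Sum.inr e) + minusExp p (Sum.inr e) = p.edges.count (e : Sym2 V) := by
  induction p with
  | nil => simp
  | @cons u v x h p ih =>
    simp only [plusExp_cons, minusExp_cons, Finsupp.add_apply, Walk.edges_cons, List.count_cons,
      ← ih, Finsupp.single_apply, Sum.inr.injEq, Subtype.ext_iff, beq_iff_eq]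
    ring

/-- No edge is repeated, so the two monomials are squarefree and coprime; divisibility by them can
be tested on supports. -/
theorem walkExp_apply_le_one {u v : V} {p : G.Walk u v} (hp : p.IsTrail) (i : V ⊕ G.edgeSet) :
    plusExp p i + minusExp p i ≤ 1 := by
  cases i with
  | inl x => simp
  | inr e =>
    classical
    rw [walkExp_inr]
    exact List.nodup_iff_count_le_one.mp hp.edges_nodup _

theorem mem_edges_iff_walkExp {u v : V} (p : G.Walk u v) (e : G.edgeSet) :
    (e : Sym2 V) ∈ p.edges ↔ 0 < plusExp p (Sum.inr e) ∨ 0 < minusExp p (Sum.inr e) := by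
  classical
  rw [← List.count_pos_iff, ← walkExp_inr]
  omega

theorem plusExp_le {u v : V} {p : G.Walk u v} (hp : p.IsTrail) {a : V ⊕ G.edgeSet →₀ ℕ}
    (h : ∀ i, 0 < plusExp p i → 0 < a i) : plusExp p ≤ a := by
  intro i
  have := walkExp_apply_le_one hp i
  have := h i
  omega

theorem minusExp_le {u v : V} {p : G.Walk u v} (hp : p.IsTrail) {a : V ⊕ G.edgeSet →₀ ℕ}
    (h : ∀ i, 0 < minusExp p i → 0 < a i) : minusExp p ≤ a := by
  intro i
  have := walkExp_apply_le_one hp i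
  have := h i
  omega

theorem mem_support_of_walkExp {u v : V} (p : G.Walk u v) {e : G.edgeSet}
    (h : 0 < plusExp p (Sum.inr e) ∨ 0 < minusExp p (Sum.inr e)) {x : V} (hx : x ∈ (e : Sym2 V)) :
    x ∈ p.support :=
  Walk.mem_support_of_mem_edges ((mem_edges_iff_walkExp p e).2 h) hx

/-- Only the first edge of a path contains its start, and its number is odd. -/
theorem plusExp_start_eq_zero {u v : V} {p : G.Walk u v} (hp : p.IsPath) {e : G.edgeSet}
    (he : u ∈ (e : Sym2 V)) : plusExp p (Sum.inr e) = 0 := by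
  cases p with
  | nil => simp
  | cons h p =>
    by_contra h0
    exact ((Walk.cons_isPath_iff _ _).1 hp).2
      (mem_support_of_walkExp p (.inr (Nat.pos_of_ne_zero h0)) he)

/-! ### The bigrading and the walk binomials -/

/-- The vertices of a variable: the vertex itself, or the two ends of the edge. -/
noncomputable def incidence (R : Type*) [CommSemiring R] : V ⊕ G.edgeSet → (V →₀ R) :=
  Sum.elim (fun v => single v 1) fun e =>
    Sym2.lift ⟨fun u v => single u 1 + single v 1, fun _ _ => add_comm _ _⟩ (e : Sym2 V)

/-- The exponent vector, in the variables of `V`, of the image of a monomial of `S`. -/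
noncomputable def vertexDegree (G : SimpleGraph V) (R : Type*) [CommSemiring R] :
    (V ⊕ G.edgeSet →₀ R) →ₗ[R] (V →₀ R) :=
  linearCombination R (incidence R)

/-- The exponent of `t` in the image of a monomial of `S`. -/
noncomputable def edgeDegree (G : SimpleGraph V) (R : Type*) [CommSemiring R] :
    (V ⊕ G.edgeSet →₀ R) →ₗ[R] R :=
  linearCombination R (Sum.elim (fun _ => 0) fun _ => 1)

section Degree

variable {R : Type*} [CommSemiring R]

@[simp] theorem vertexDegree_inl (v : V) (r : R) :
    vertexDegree G R (single (Sum.inl v) r) = single v r := by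
  simp [vertexDegree, incidence]

@[simp] theorem vertexDegree_inr {u v : V} (h : G.Adj u v) (r : R) :
    vertexDegree G R (single (Sum.inr ⟨s(u, v), h⟩) r) = single u r + single v r := by
  simp [vertexDegree, incidence]

@[simp] theorem edgeDegree_inl (v : V) (r : R) :
    edgeDegree G R (single (Sum.inl v) r) = 0 := by
  simp [edgeDegree]

@[simp] theorem edgeDegree_inr (e : G.edgeSet) (r : R) :
    edgeDegree G R (single (Sum.inr e) r) = r := by
  simp [edgeDegree]

theorem incidence_inr_of_notMem {x : V} {e : G.edgeSet} (h : x ∉ (e : Sym2 V)) :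
    incidence R (Sum.inr e : V ⊕ G.edgeSet) x = 0 := by
  obtain ⟨e, he⟩ := e
  induction e with
  | _ u v =>
    simp only [Sym2.mem_iff, not_or] at h
    simp [incidence, h.1, h.2]

theorem vertexDegree_apply (z : V ⊕ G.edgeSet →₀ R) (x : V) :
    vertexDegree G R z x = z.sum fun i r => r * incidence R i x := by
  simp [vertexDegree, linearCombination_apply, Finsupp.sum, Finsupp.finsetSum_apply]

theorem vertexDegree_eq_zero_of_forall {z : V ⊕ G.edgeSet →₀ R} {x : V}
    (hl : z (Sum.inl x) = 0) (hr : ∀ e : G.edgeSet, x ∈ (e : Sym2 V) → z (Sum.inr e) = 0) :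
    vertexDegree G R z x = 0 := by
  rw [vertexDegree_apply]
  refine Finset.sum_eq_zero fun i _ => ?_
  cases i with
  | inl y =>
    by_cases h : y = x
    · subst h; simp [hl]
    · simp [incidence, h]
  | inr e =>
    by_cases h : x ∈ (e : Sym2 V)
    · simp [hr e h]
    · simp [incidence_inr_of_notMem h]

end Degree

theorem vertexDegree_mono {a b : V ⊕ G.edgeSet →₀ ℕ} (h : a ≤ b) :
    vertexDegree G ℕ a ≤ vertexDegree G ℕ b := by
  obtain ⟨c, rfl⟩ := exists_add_of_le h
  rw [map_add]
  exact le_self_add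

theorem vertexDegree_pos {a : V ⊕ G.edgeSet →₀ ℕ} {u v : V} {h : G.Adj u v}
    (ha : 0 < a (Sum.inr ⟨s(u, v), h⟩)) : 0 < vertexDegree G ℕ a u := by
  have := vertexDegree_mono (G := G) (a := single (Sum.inr ⟨s(u, v), h⟩) 1) (b := a)
    (by rw [Finsupp.single_le_iff]; exact ha) u
  simp at this
  omega

theorem exists_of_vertexDegree_pos {a : V ⊕ G.edgeSet →₀ ℕ} {u : V}
    (ha : 0 < vertexDegree G ℕ a u) :
    0 < a (Sum.inl u) ∨ ∃ (v : V) (h : G.Adj v u), 0 < a (Sum.inr ⟨s(v, u), h⟩) := by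
  by_contra! hcon
  refine ha.ne' (vertexDegree_eq_zero_of_forall (by simpa using hcon.1) fun e he => ?_)
  obtain ⟨e, hadj⟩ := e
  obtain ⟨v, rfl⟩ := Sym2.mem_iff_exists.1 he
  have hadj' : G.Adj v u := (G.mem_edgeSet.1 hadj).symm
  have := hcon.2 v hadj'
  have hs : (⟨s(u, v), hadj⟩ : G.edgeSet) = ⟨s(v, u), hadj'⟩ := Subtype.ext Sym2.eq_swap
  rw [hs]; simpa using this

/-- The grading is positive: each variable has nonzero vertex degree and nothing cancels over `ℕ`.
-/
theorem eq_zero_of_vertexDegree_eq_zero {a : V ⊕ G.edgeSet →₀ ℕ} (h : vertexDegree G ℕ a = 0) :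
    a = 0 := by
  ext i
  by_contra hi
  have hle : single i 1 ≤ a := by
    rw [Finsupp.single_le_iff]
    exact Nat.one_le_iff_ne_zero.2 hi
  have := vertexDegree_mono hle
  rw [h] at this
  cases i with
  | inl v =>
    have := this v
    simp at this
  | inr e =>
    obtain ⟨e, he⟩ := e
    induction e with
    | _ u v =>
      have := this u
      rw [vertexDegree_inr he] at this
      simp at this

/-- At each inner position of the walk an odd and an even edge meet and balance; only the two ends
need a correction. -/
theorem vertexDegree_walkExp {u v : V} (w : G.Walk u v) :
    (Even w.length → single u 1 + vertexDegree G ℕ (plusExp w) =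
      single v 1 + vertexDegree G ℕ (minusExp w)) ∧
    (Odd w.length → single u 1 + single v 1 + vertexDegree G ℕ (plusExp w) =
      vertexDegree G ℕ (minusExp w)) := by
  induction w with
  | nil => simp
  | cons h p ih =>
    simp only [Walk.length_cons, Nat.even_add_one, Nat.odd_add_one, Nat.not_even_iff_odd,
      Nat.not_odd_iff_even, plusExp_cons, minusExp_cons, map_add, vertexDegree_inr]
    refine ⟨fun ho => ?_, fun he => ?_⟩
    · rw [← ih.2 ho]; abel
    · rw [add_assoc, ← ih.1 he]; abel

/-- The defect 1 for odd walks is the reason why odd paths enter the list only in pairs. -/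
theorem edgeDegree_walkExp {u v : V} (w : G.Walk u v) :
    (Even w.length → edgeDegree G ℕ (plusExp w) = edgeDegree G ℕ (minusExp w)) ∧
    (Odd w.length → edgeDegree G ℕ (plusExp w) + 1 = edgeDegree G ℕ (minusExp w)) := by
  induction w with
  | nil => simp
  | cons h p ih =>
    simp only [Walk.length_cons, Nat.even_add_one, Nat.odd_add_one, Nat.not_even_iff_odd,
      Nat.not_odd_iff_even, plusExp_cons, minusExp_cons, map_add, edgeDegree_inr]
    refine ⟨fun ho => ?_, fun he => ?_⟩
    · rw [← ih.2 ho]; ring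
    · rw [← ih.1 he]; ring

/-- The pairs of exponent vectors of the binomials attached to the even cycles, the even paths and
the pairs of disjoint odd paths of `G`. -/
inductive IsWalkPair (G : SimpleGraph V) :
    (V ⊕ G.edgeSet →₀ ℕ) → (V ⊕ G.edgeSet →₀ ℕ) → Prop
  | cycle {v : V} (w : G.Walk v v) : w.IsCycle → Even w.length →
      IsWalkPair G (plusExp w) (minusExp w)
  | path {u v : V} (w : G.Walk u v) : w.IsPath → Even w.length → 0 < w.length →
      IsWalkPair G (single (Sum.inl u) 1 + plusExp w) (single (Sum.inl v) 1 + minusExp w)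
  | pair {u₀ u₁ v₀ v₁ : V} (w₁ : G.Walk u₀ u₁) (w₂ : G.Walk v₀ v₁) :
      w₁.IsPath → Odd w₁.length → w₂.IsPath → Odd w₂.length →
      w₁.support.Disjoint w₂.support →
      IsWalkPair G (single (Sum.inl u₀) 1 + single (Sum.inl u₁) 1 + (plusExp w₁ + minusExp w₂))
        (single (Sum.inl v₀) 1 + single (Sum.inl v₁) 1 + (minusExp w₁ + plusExp w₂))

theorem IsWalkPair.symm {c d : V ⊕ G.edgeSet →₀ ℕ} (h : IsWalkPair G c d) :
    IsWalkPair G d c := by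
  cases h with
  | cycle w hw he =>
    have := IsWalkPair.cycle w.reverse hw.reverse (by simpa using he)
    rwa [((walkExp_reverse w).1 he).1, ((walkExp_reverse w).1 he).2] at this
  | path w hw he h0 =>
    have := IsWalkPair.path w.reverse hw.reverse (by simpa using he) (by simpa using h0)
    rwa [((walkExp_reverse w).1 he).1, ((walkExp_reverse w).1 he).2] at this
  | pair w₁ w₂ h₁ o₁ h₂ o₂ hd =>
    rw [add_comm (minusExp w₁), add_comm (plusExp w₁)]
    exact .pair w₂ w₁ h₂ o₂ h₁ o₁ hd.symm

theorem IsWalkPair.vertexDegree_eq {c d : V ⊕ G.edgeSet →₀ ℕ} (h : IsWalkPair G c d) :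
    vertexDegree G ℕ c = vertexDegree G ℕ d := by
  cases h with
  | cycle w hw he => simpa using (vertexDegree_walkExp w).1 he
  | path w hw he h0 => simpa using (vertexDegree_walkExp w).1 he
  | pair w₁ w₂ h₁ o₁ h₂ o₂ hd =>
    simp only [map_add, vertexDegree_inl, ← (vertexDegree_walkExp w₁).2 o₁,
      ← (vertexDegree_walkExp w₂).2 o₂]
    abel

theorem IsWalkPair.edgeDegree_eq {c d : V ⊕ G.edgeSet →₀ ℕ} (h : IsWalkPair G c d) :
    edgeDegree G ℕ c = edgeDegree G ℕ d := by
  cases h with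
  | cycle w hw he => simpa using (edgeDegree_walkExp w).1 he
  | path w hw he h0 => simpa using (edgeDegree_walkExp w).1 he
  | pair w₁ w₂ h₁ o₁ h₂ o₂ hd =>
    simp only [map_add, edgeDegree_inl, ← (edgeDegree_walkExp w₁).2 o₁,
      ← (edgeDegree_walkExp w₂).2 o₂]
    ring

end Exponents

end BipartiteRees

namespace BipartiteRees

open SimpleGraph Finsupp

/-! ### Splicing paths inside a binomial -/

section Conformal

variable {V : Type u} {G : SimpleGraph V}

/-- Cuts `w` at its first vertex in `s`. With `s` the support of another path, the initial piece
meets that path only at the cut. -/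
theorem exists_append_of_mem_support {u v : V} (w : G.Walk u v) (s : Set V)
    (h : ∃ x ∈ w.support, x ∈ s) :
    ∃ (x : V) (p : G.Walk u x) (q : G.Walk x v),
      x ∈ s ∧ w = p.append q ∧ ∀ y ∈ p.support, y ∈ s → y = x := by
  induction w with
  | @nil u =>
    obtain ⟨x, hx, hs⟩ := h
    rw [Walk.support_nil, List.mem_singleton] at hx
    subst hx
    exact ⟨x, .nil, .nil, hs, rfl, by simp⟩
  | @cons u v x hadj p ih =>
    by_cases hu : u ∈ s
    · exact ⟨u, .nil, .cons hadj p, hu, rfl, by simp⟩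
    · obtain ⟨y, hy, hys⟩ := h
      have : y ∈ p.support := by
        rw [Walk.support_cons, List.mem_cons] at hy
        rcases hy with rfl | hy
        · exact absurd hys hu
        · exact hy
      obtain ⟨z, q, r, hz, rfl, hq⟩ := ih ⟨y, this, hys⟩
      refine ⟨z, .cons hadj q, r, hz, rfl, ?_⟩
      intro a ha has
      rw [Walk.support_cons, List.mem_cons] at ha
      rcases ha with rfl | ha
      · exact absurd has hu
      · exact hq a ha has

theorem isPath_append {u x v : V} {p : G.Walk u x} {q : G.Walk x v} (hp : p.IsPath)
    (hq : q.IsPath) (h : ∀ y ∈ p.support, y ∈ q.support → y = x) : (p.append q).IsPath := by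
  rw [Walk.isPath_def, Walk.support_append, List.nodup_append']
  have hq' := hq.support_nodup
  rw [← Walk.cons_tail_support, List.nodup_cons] at hq'
  refine ⟨hp.support_nodup, hq'.2, fun y hy hy' => ?_⟩
  have := h y hy (List.mem_of_mem_tail hy')
  exact hq'.1 (this ▸ hy')

/-- Some pair of exponent vectors attached to a cycle, a path or a pair of paths of `G`
lies below `(a, b)`. -/
def HasWalkPairLE (a b : V ⊕ G.edgeSet →₀ ℕ) : Prop :=
  ∃ c d, IsWalkPair G c d ∧ c ≤ a ∧ d ≤ b

/-- Some odd path `w = (v_0, …, v_k)` has `v_0 v_k T_{w^+}` below `a` and `T_{w^-}` below `b`. -/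
def HasOddPathLE (a b : V ⊕ G.edgeSet →₀ ℕ) : Prop :=
  ∃ (u v : V) (w : G.Walk u v), w.IsPath ∧ Odd w.length ∧
    single (Sum.inl u) 1 + single (Sum.inl v) 1 + plusExp w ≤ a ∧ minusExp w ≤ b

theorem HasWalkPairLE.symm {a b : V ⊕ G.edgeSet →₀ ℕ} (h : HasWalkPairLE a b) :
    HasWalkPairLE b a := by
  obtain ⟨c, d, hcd, hc, hd⟩ := h
  exact ⟨d, c, hcd.symm, hd, hc⟩

theorem HasWalkPairLE.mono {a b a' b' : V ⊕ G.edgeSet →₀ ℕ} (h : HasWalkPairLE a b) (ha : a ≤ a')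
    (hb : b ≤ b') : HasWalkPairLE a' b' := by
  obtain ⟨c, d, hcd, hc, hd⟩ := h
  exact ⟨c, d, hcd, hc.trans ha, hd.trans hb⟩

theorem HasOddPathLE.mono {a b a' b' : V ⊕ G.edgeSet →₀ ℕ} (h : HasOddPathLE a b) (ha : a ≤ a')
    (hb : b ≤ b') : HasOddPathLE a' b' := by
  obtain ⟨u, v, w, hw, ho, h1, h2⟩ := h
  exact ⟨u, v, w, hw, ho, h1.trans ha, h2.trans hb⟩

theorem hasWalkPairLE_of_isPath {a b : V ⊕ G.edgeSet →₀ ℕ} {u v : V} {w : G.Walk u v}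
    (hw : w.IsPath) (he : Even w.length) (h0 : 0 < w.length) (hu : 0 < a (Sum.inl u))
    (hv : 0 < b (Sum.inl v)) (ha : ∀ i, 0 < plusExp w i → 0 < a i)
    (hb : ∀ i, 0 < minusExp w i → 0 < b i) : HasWalkPairLE a b := by
  refine ⟨_, _, .path w hw he h0, fun i => ?_, fun i => ?_⟩
  · have h1 := plusExp_le hw.isTrail ha i
    cases i with
    | inl x =>
      by_cases hx : u = x
      · subst hx; simpa using Nat.succ_le_of_lt hu
      · simp [hx]
    | inr e => simpa using h1
  · have h1 := minusExp_le hw.isTrail hb i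
    cases i with
    | inl x =>
      by_cases hx : v = x
      · subst hx; simpa using Nat.succ_le_of_lt hv
      · simp [hx]
    | inr e => simpa using h1

theorem hasOddPathLE_of_isPath {a b : V ⊕ G.edgeSet →₀ ℕ} {u v : V} {w : G.Walk u v}
    (hw : w.IsPath) (ho : Odd w.length) (hu : 0 < a (Sum.inl u))
    (hv : 0 < a (Sum.inl v)) (ha : ∀ i, 0 < plusExp w i → 0 < a i)
    (hb : ∀ i, 0 < minusExp w i → 0 < b i) : HasOddPathLE a b := by
  refine ⟨_, _, w, hw, ho, fun i => ?_, minusExp_le hw.isTrail hb⟩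
  have h1 := plusExp_le hw.isTrail ha i
  have huv : u ≠ v := by
    rintro rfl
    rw [(hw.nil_iff_eq.2 rfl).eq_nil] at ho
    simp at ho
  cases i with
  | inl x =>
    by_cases hx : u = x
    · subst hx
      simpa [huv.symm] using Nat.succ_le_of_lt hu
    · by_cases hx' : v = x
      · subst hx'
        simpa [hx] using Nat.succ_le_of_lt hv
      · simp [hx, hx']
  | inr e => simpa using h1

/-- The two pieces into which `x` cuts the odd path `r.append t` are chosen so that the first one
is even. -/
theorem hasWalkPairLE_of_append {a b : V ⊕ G.edgeSet →₀ ℕ} (hab : ∀ i, a i = 0 ∨ b i = 0)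
    {u x v v' : V} {p : G.Walk u x} {r : G.Walk v x} {t : G.Walk x v'} (hp : p.IsPath)
    (hrt : (r.append t).IsPath) (hr : Even r.length) (ht : Odd t.length)
    (hx : ∀ y ∈ p.support, y ∈ (r.append t).support → y = x)
    (hu : 0 < a (Sum.inl u)) (hv : 0 < b (Sum.inl v)) (hv' : 0 < b (Sum.inl v'))
    (hpa : plusExp p ≤ a) (hpb : minusExp p ≤ b)
    (hb : plusExp (r.append t) ≤ b) (ha : minusExp (r.append t) ≤ a) : HasWalkPairLE a b := by
  have h1 := (walkExp_append r t).1 hr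
  rw [h1.1] at hb
  rw [h1.2] at ha
  -- An even `p` is continued by `r` backwards, an odd one by `t`. Either way the result is an even
  -- path from `u` to an end of the second path, and the parities put its edges on the correct
  -- sides.
  rcases Nat.even_or_odd p.length with he | ho
  · have h2 := (walkExp_append p r.reverse).1 he
    have h3 := (walkExp_reverse r).1 hr
    refine hasWalkPairLE_of_isPath (w := p.append r.reverse) ?_ ?_ ?_ hu hv ?_ ?_
    · refine isPath_append hp hrt.of_append_left.reverse fun y hy hy' => hx y hy ?_
      rw [Walk.support_reverse, List.mem_reverse] at hy'
      exact Walk.support_subset_support_append_left _ _ hy'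
    · simpa [Nat.even_add, he] using hr
    -- If both pieces were trivial, one vertex variable would occur in both `a` and `b`.
    · by_contra h0
      rw [Walk.length_append, Walk.length_reverse] at h0
      have hux := Walk.eq_of_length_eq_zero (p := p) (by omega)
      have hvx := Walk.eq_of_length_eq_zero (p := r) (by omega)
      subst hux hvx
      rcases hab (Sum.inl _) with h | h
      · exact hu.ne' h
      · exact hv.ne' h
    · intro i hi
      have := hpa i
      have := ha i
      rw [h2.1, h3.1] at hi
      simp only [Finsupp.add_apply] at *
      omega
    · intro i hi
      have := hpb i
      have := hb i
      rw [h2.2, h3.2] at hi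
      simp only [Finsupp.add_apply] at *
      omega
  · have h2 := (walkExp_append p t).2 ho
    refine hasWalkPairLE_of_isPath (w := p.append t) ?_ ?_ ?_ hu hv' ?_ ?_
    · exact isPath_append hp hrt.of_append_right fun y hy hy' => hx y hy
        (Walk.support_subset_support_append_right _ _ hy')
    · rw [Walk.length_append]
      exact ho.add_odd ht
    · rw [Walk.length_append]
      exact Nat.add_pos_left ho.pos _
    · intro i hi
      have := hpa i
      have := ha i
      rw [h2.1] at hi
      simp only [Finsupp.add_apply] at *
      omega
    · intro i hi
      have := hpb i
      have := hb i
      rw [h2.2] at hi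
      simp only [Finsupp.add_apply] at *
      omega

theorem single_inl_pos_of_le {a c : V ⊕ G.edgeSet →₀ ℕ} {u v : V}
    (h : single (Sum.inl u) 1 + single (Sum.inl v) 1 + c ≤ a) :
    0 < a (Sum.inl u) ∧ 0 < a (Sum.inl v) := by
  have h1 := h (Sum.inl u)
  have h2 := h (Sum.inl v)
  simp only [Finsupp.add_apply, Finsupp.single_eq_same] at h1 h2
  omega

/-- Disjoint paths form a pair. Otherwise the first path is followed up to the first vertex of the
second and then left along the second in the direction that makes the total length even. -/
theorem hasWalkPairLE_of_hasOddPathLE {a b : V ⊕ G.edgeSet →₀ ℕ} (hab : ∀ i, a i = 0 ∨ b i = 0)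
    (h₁ : HasOddPathLE a b) (h₂ : HasOddPathLE b a) : HasWalkPairLE a b := by
  obtain ⟨u₀, u₁, w₁, hw₁, ho₁, ha₁, hb₁⟩ := h₁
  obtain ⟨v₀, v₁, w₂, hw₂, ho₂, hb₂, ha₂⟩ := h₂
  by_cases hd : w₁.support.Disjoint w₂.support
  · refine ⟨_, _, .pair w₁ w₂ hw₁ ho₁ hw₂ ho₂ hd, fun i => ?_, fun i => ?_⟩
    all_goals
      have h1 := ha₁ i
      have h2 := ha₂ i
      have h3 := hb₁ i
      have h4 := hb₂ i
      cases i with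
      | inl x => simp_all
      | inr e =>
        have hdisj : ¬ ((0 < plusExp w₁ (Sum.inr e) ∨ 0 < minusExp w₁ (Sum.inr e)) ∧
            (0 < plusExp w₂ (Sum.inr e) ∨ 0 < minusExp w₂ (Sum.inr e))) := by
          rintro ⟨hl, hr⟩
          obtain ⟨x, hx⟩ : ∃ x, x ∈ (e : Sym2 V) := ⟨_, Sym2.out_fst_mem _⟩
          exact hd (mem_support_of_walkExp w₁ hl hx) (mem_support_of_walkExp w₂ hr hx)
        simp only [Finsupp.add_apply, ne_eq, reduceCtorEq, not_false_eq_true,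
          Finsupp.single_eq_of_ne] at *
        omega
  · have hex : ∃ x ∈ w₁.support, x ∈ {y | y ∈ w₂.support} := by
      by_contra! hcon
      exact hd fun x hx hx' => hcon x hx hx'
    obtain ⟨x, p, q, hx, rfl, hpx⟩ := exists_append_of_mem_support w₁ _ hex
    obtain ⟨r, t, rfl⟩ := Walk.mem_support_iff_exists_append.1 hx
    have hua := (single_inl_pos_of_le ha₁).1
    have hvb := single_inl_pos_of_le hb₂
    have hpa : plusExp p ≤ a := (plusExp_le_append p q).trans (le_add_self.trans ha₁)
    have hpb : minusExp p ≤ b := (minusExp_le_append p q).trans hb₁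
    have hb : plusExp (r.append t) ≤ b := le_add_self.trans hb₂
    have hlen := ho₂
    rw [Walk.length_append, Nat.odd_add] at hlen
    -- The two pieces of the odd path have opposite parities; if the first is odd, the path is
    -- reversed.
    rcases Nat.even_or_odd r.length with he | ho
    · exact hasWalkPairLE_of_append hab hw₁.of_append_left hw₂ he
        (by rw [← Nat.not_even_iff_odd, ← hlen, Nat.not_odd_iff_even]; exact he) hpx hua hvb.1 hvb.2
        hpa hpb hb ha₂
    · have hrev := (walkExp_reverse (r.append t)).2 ho₂
      rw [Walk.reverse_append] at hrev
      refine hasWalkPairLE_of_append hab (r := t.reverse) (t := r.reverse) hw₁.of_append_left ?_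
        ?_ ?_ ?_ hua hvb.2 hvb.1 hpa hpb (by rwa [hrev.1]) (by rwa [hrev.2])
      · rw [← Walk.reverse_append]; exact hw₂.reverse
      · rw [Walk.length_reverse]; exact hlen.1 ho
      · rwa [Walk.length_reverse]
      · intro y hy hy'
        rw [← Walk.reverse_append, Walk.support_reverse, List.mem_reverse] at hy'
        exact hpx y hy hy'

/-- The only place where bipartiteness itself enters: it makes the cycles closed up from alternating
paths even. -/
theorem even_length_of_isBipartite (hG : G.IsBipartite) {v : V} (w : G.Walk v v) :
    Even w.length := by
  obtain ⟨c⟩ := hG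
  let c' : G.Coloring Bool := G.recolorOfEquiv finTwoEquiv c
  exact (c'.even_length_iff_congr w).2 Iff.rfl

/-! ### Longest alternating paths -/

/-- At the start of a longest alternating path there is a vertex variable, or the path can be
closed to an alternating cycle. -/
theorem start_of_longest (hG : G.IsBipartite) {a b : V ⊕ G.edgeSet →₀ ℕ}
    (hab : ∀ i, a i = 0 ∨ b i = 0) (hdeg : vertexDegree G ℕ a = vertexDegree G ℕ b)
    {u v : V} {w : G.Walk u v} (hw : w.IsPath) (h0 : 0 < w.length)
    (ha : plusExp w ≤ a) (hb : minusExp w ≤ b)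
    (hmax : ∀ (x y : V) (q : G.Walk x y), q.IsPath → plusExp q ≤ b → minusExp q ≤ a →
      q.length ≤ w.length) :
    HasWalkPairLE a b ∨ 0 < a (Sum.inl u) := by
  -- The first edge of `w` lies in `b`, so `u` has positive degree in `b`, hence also in `a`: some
  -- variable of `a` involves `u`.
  have hub : 0 < vertexDegree G ℕ b u := by
    cases w with
    | nil => simp at h0
    | @cons _ y _ h p =>
      refine vertexDegree_pos (h := h) ?_
      have := hb (Sum.inr ⟨s(u, y), h⟩)
      simp only [minusExp_cons, Finsupp.add_apply, Finsupp.single_eq_same] at this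
      omega
  rw [← hdeg] at hub
  rcases exists_of_vertexDegree_pos hub with h | ⟨x, hadj, hpos⟩
  · exact .inr h
  left
  -- The edge `xu` of `a` can be prepended without exceeding its multiplicity in `a`, as no
  -- even-numbered edge of `q` contains `u`.
  have key : ∀ {y : V} (q : G.Walk u y), q.IsPath → plusExp q ≤ a →
      minusExp (.cons hadj q) ≤ a := by
    intro y q hq hqa i
    have h1 := hqa i
    by_cases hi : i = Sum.inr ⟨s(x, u), hadj⟩
    · subst hi
      rw [minusExp_cons, Finsupp.add_apply, plusExp_start_eq_zero hq (Sym2.mem_mk_right _ _)]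
      simpa using Nat.succ_le_of_lt hpos
    · simpa [Finsupp.single_eq_of_ne hi] using h1
  -- If `x` lies on `w`, the edge closes an initial segment to a cycle; otherwise it gives a longer
  -- alternating path.
  by_cases hx : x ∈ w.support
  · obtain ⟨q, r, rfl⟩ := Walk.mem_support_iff_exists_append.1 hx
    have hq := hw.of_append_left
    have hqa := (plusExp_le_append q r).trans ha
    have hqb := (minusExp_le_append q r).trans hb
    refine HasWalkPairLE.symm ⟨_, _, .cycle (.cons hadj q) ?_ (even_length_of_isBipartite hG _), hqb,
      key q hq hqa⟩
    rw [Walk.cons_isCycle_iff]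
    refine ⟨hq, fun hmem => ?_⟩
    -- The closing edge is not already in `q`: an edge of `q` at `u` belongs to `b`, while this one
    -- belongs to `a`.
    rcases (mem_edges_iff_walkExp q ⟨s(x, u), hadj⟩).1 hmem with h | h
    · rw [plusExp_start_eq_zero hq (Sym2.mem_mk_right _ _)] at h
      exact h.ne rfl
    · have := hqb (Sum.inr ⟨s(x, u), hadj⟩)
      have := hab (Sum.inr ⟨s(x, u), hadj⟩)
      omega
  · have := hmax x v (.cons hadj w) (hw.cons hx) hb (key w hw ha)
    simp at this

/-- The start argument is applied to `w` and to its reverse. For even `w` reversal exchanges `a` and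
`b`, so the end variables lie on opposite sides and give an even path; for odd `w` both lie in `a`.
-/
theorem hasWalkPairLE_or_of_longest (hG : G.IsBipartite) {a b : V ⊕ G.edgeSet →₀ ℕ}
    (hab : ∀ i, a i = 0 ∨ b i = 0) (hdeg : vertexDegree G ℕ a = vertexDegree G ℕ b)
    {u v : V} {w : G.Walk u v} (hw : w.IsPath) (h0 : 0 < w.length)
    (ha : plusExp w ≤ a) (hb : minusExp w ≤ b)
    (hmax : ∀ (x y : V) (q : G.Walk x y), q.IsPath →
      (plusExp q ≤ a ∧ minusExp q ≤ b) ∨ (plusExp q ≤ b ∧ minusExp q ≤ a) →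
      q.length ≤ w.length) :
    HasWalkPairLE a b ∨ HasOddPathLE a b := by
  rcases start_of_longest hG hab hdeg hw h0 ha hb
    (fun x y q hq h1 h2 => hmax x y q hq (.inr ⟨h1, h2⟩)) with h | hu
  · exact .inl h
  have hpos : ∀ {c d : V ⊕ G.edgeSet →₀ ℕ}, c ≤ d → ∀ i, 0 < c i → 0 < d i :=
    fun hcd i hi => hi.trans_le (hcd i)
  rcases Nat.even_or_odd w.length with he | ho
  · have hr := (walkExp_reverse w).1 he
    rcases start_of_longest hG (fun i => (hab i).symm) hdeg.symm hw.reverse (by simpa using h0)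
      (by rwa [hr.1]) (by rwa [hr.2]) (fun x y q hq h1 h2 => by
        rw [Walk.length_reverse]; exact hmax x y q hq (.inl ⟨h1, h2⟩)) with h | hv
    · exact .inl h.symm
    · exact .inl (hasWalkPairLE_of_isPath hw he h0 hu hv (hpos ha) (hpos hb))
  · have hr := (walkExp_reverse w).2 ho
    rcases start_of_longest hG hab hdeg hw.reverse (by simpa using h0)
      (by rwa [hr.1]) (by rwa [hr.2]) (fun x y q hq h1 h2 => by
        rw [Walk.length_reverse]; exact hmax x y q hq (.inr ⟨h1, h2⟩)) with h | hv
    · exact .inl h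
    · exact .inr (hasOddPathLE_of_isPath hw ho hu hv (hpos ha) (hpos hb))

variable [Finite V]

theorem hasWalkPairLE_or (hG : G.IsBipartite) {a b : V ⊕ G.edgeSet →₀ ℕ}
    (hab : ∀ i, a i = 0 ∨ b i = 0) (hdeg : vertexDegree G ℕ a = vertexDegree G ℕ b)
    (hne : a ≠ b) : HasWalkPairLE a b ∨ HasOddPathLE a b ∨ HasOddPathLE b a := by
  classical
  have := Fintype.ofFinite V
  let P : ℕ → Prop := fun n => ∃ (x y : V) (q : G.Walk x y), q.IsPath ∧
    ((plusExp q ≤ a ∧ minusExp q ≤ b) ∨ (plusExp q ≤ b ∧ minusExp q ≤ a)) ∧ q.length = n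
  have hbound : ∀ n, P n → n ≤ Fintype.card V := by
    rintro n ⟨x, y, q, hq, -, rfl⟩
    exact hq.length_lt.le
  -- Without any edge variable in `a` or `b`, the vertex degrees are the exponents themselves, and
  -- `a = b`.
  have hone : P 1 := by
    by_contra hP
    have hz : ∀ e : G.edgeSet, a (Sum.inr e) = 0 ∧ b (Sum.inr e) = 0 := by
      rintro ⟨e, he⟩
      induction e with
      | _ u v =>
        by_contra hcon
        have hadj : G.Adj u v := he
        refine hP ⟨u, v, .cons hadj .nil, by simpa using hadj.ne, ?_, rfl⟩
        rw [plusExp_cons, minusExp_cons, plusExp_nil, minusExp_nil, add_zero,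
          Finsupp.single_le_iff, Finsupp.single_le_iff]
        simp only [zero_le, true_and]
        omega
    apply hne
    ext i
    cases i with
    | inr e => rw [(hz e).1, (hz e).2]
    | inl x =>
      have hval : ∀ c : V ⊕ G.edgeSet →₀ ℕ, (∀ e, c (Sum.inr e) = 0) →
          vertexDegree G ℕ c x = c (Sum.inl x) := by
        intro c hc
        conv_lhs => rw [← Finsupp.erase_add_single (Sum.inl x) c]
        rw [map_add, Finsupp.add_apply,
          vertexDegree_eq_zero_of_forall (by simp) (fun e _ => by simp [hc])]
        simp
      rw [← hval a fun e => (hz e).1, ← hval b fun e => (hz e).2, hdeg]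
  have hP := Nat.findGreatest_spec (hbound 1 hone) hone
  obtain ⟨u, v, w, hw, hwab, hlen⟩ := hP
  have hmax : ∀ (x y : V) (q : G.Walk x y), q.IsPath →
      (plusExp q ≤ a ∧ minusExp q ≤ b) ∨ (plusExp q ≤ b ∧ minusExp q ≤ a) →
      q.length ≤ w.length := by
    intro x y q hq h
    have hq' : P q.length := ⟨x, y, q, hq, h, rfl⟩
    rw [hlen]
    exact Nat.le_findGreatest (hbound _ hq') hq'
  have h0 : 0 < w.length := by
    rw [hlen]
    exact Nat.le_findGreatest (hbound 1 hone) hone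
  rcases hwab with ⟨h1, h2⟩ | ⟨h1, h2⟩
  · rcases hasWalkPairLE_or_of_longest hG hab hdeg hw h0 h1 h2 hmax with h | h
    · exact .inl h
    · exact .inr (.inl h)
  · rcases hasWalkPairLE_or_of_longest hG (fun i => (hab i).symm) hdeg.symm hw h0 h1 h2
      (fun x y q hq h => hmax x y q hq h.symm) with h | h
    · exact .inl h.symm
    · exact .inr (.inr h)

/-- An odd path of the unwanted kind can be divided out: this lowers the edge degree of `a` and
widens its gap to that of `b` by one, so induction applies. In degree 0 no such path exists, since
it uses an edge of `a`. -/
theorem hasWalkPairLE_or_of_edgeDegree_lt (hG : G.IsBipartite) (n : ℕ) :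
    ∀ {a b : V ⊕ G.edgeSet →₀ ℕ}, edgeDegree G ℕ a ≤ n → (∀ i, a i = 0 ∨ b i = 0) →
      vertexDegree G ℕ a = vertexDegree G ℕ b → edgeDegree G ℕ a < edgeDegree G ℕ b →
      HasWalkPairLE a b ∨ HasOddPathLE a b := by
  induction n with
  | zero =>
    intro a b hn hab hdeg hlt
    rcases hasWalkPairLE_or hG hab hdeg (by rintro rfl; exact hlt.ne rfl) with h | h | h
    · exact .inl h
    · exact .inr h
    · obtain ⟨u, v, w, hw, ho, hb, ha⟩ := h
      obtain ⟨a', rfl⟩ := exists_add_of_le ha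
      rw [map_add, ← (edgeDegree_walkExp w).2 ho] at hn
      omega
  | succ n ih =>
    intro a b hn hab hdeg hlt
    rcases hasWalkPairLE_or hG hab hdeg (by rintro rfl; exact hlt.ne rfl) with h | h | h
    · exact .inl h
    · exact .inr h
    · obtain ⟨u, v, w, hw, ho, hb, ha⟩ := h
      obtain ⟨a', rfl⟩ := exists_add_of_le ha
      obtain ⟨b', rfl⟩ := exists_add_of_le hb
      simp only [map_add, ← (edgeDegree_walkExp w).2 ho, edgeDegree_inl] at hn hlt
      have := ih (a := a') (b := b') (by omega) (fun i => by
        have := hab i; simp only [Finsupp.add_apply] at this; omega) ?_ (by omega)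
      · exact this.imp (fun h => h.mono le_add_self le_add_self)
          fun h => h.mono le_add_self le_add_self
      · simp only [map_add, ← (vertexDegree_walkExp w).2 ho, vertexDegree_inl] at hdeg
        exact add_left_cancel hdeg

/-- Every nontrivial binomial of the kernel is divisible, term by term, by a binomial attached to an
even cycle, an even path, or a pair of disjoint odd paths. -/
theorem hasWalkPairLE_of_disjoint (hG : G.IsBipartite) {a b : V ⊕ G.edgeSet →₀ ℕ}
    (hab : ∀ i, a i = 0 ∨ b i = 0) (hdeg : vertexDegree G ℕ a = vertexDegree G ℕ b)
    (hedge : edgeDegree G ℕ a = edgeDegree G ℕ b) (hne : a ≠ b) : HasWalkPairLE a b := by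
  wlog h : HasWalkPairLE a b ∨ HasOddPathLE a b generalizing a b with H
  · rcases hasWalkPairLE_or hG hab hdeg hne with h' | h' | h'
    · exact h'
    · exact absurd (.inr h') h
    · exact (H (fun i => (hab i).symm) hdeg.symm hedge.symm hne.symm (.inr h')).symm
  rcases h with h | h
  · exact h
  obtain ⟨u, v, w, hw, ho, ha, hb⟩ := id h
  obtain ⟨a', rfl⟩ := exists_add_of_le ha
  obtain ⟨b', rfl⟩ := exists_add_of_le hb
  simp only [map_add, ← (edgeDegree_walkExp w).2 ho, edgeDegree_inl] at hedge
  -- Dividing out the odd path leaves `b'` with edge degree one less than `a'`; this imbalance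
  -- yields a listed binomial or the odd path of opposite kind.
  have := hasWalkPairLE_or_of_edgeDegree_lt hG _ (a := b') (b := a') le_rfl (fun i => by
    have := hab i; simp only [Finsupp.add_apply] at this; omega) ?_ (by omega)
  · rcases this with h' | h'
    · exact (h'.mono le_add_self le_add_self).symm
    · exact hasWalkPairLE_of_hasOddPathLE hab h (h'.mono le_add_self le_add_self)
  · simp only [map_add, ← (vertexDegree_walkExp w).2 ho, vertexDegree_inl] at hdeg
    exact (add_left_cancel hdeg).symm

theorem hasWalkPairLE_of_ne (hG : G.IsBipartite) {a b : V ⊕ G.edgeSet →₀ ℕ}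
    (hdeg : vertexDegree G ℕ a = vertexDegree G ℕ b)
    (hedge : edgeDegree G ℕ a = edgeDegree G ℕ b) (hne : a ≠ b) : HasWalkPairLE a b := by
  obtain ⟨a', ha⟩ := exists_add_of_le (inf_le_left : a ⊓ b ≤ a)
  obtain ⟨b', hb⟩ := exists_add_of_le (inf_le_right : a ⊓ b ≤ b)
  have hda := congrArg (vertexDegree G ℕ) ha
  have hdb := congrArg (vertexDegree G ℕ) hb
  have hea := congrArg (edgeDegree G ℕ) ha
  have heb := congrArg (edgeDegree G ℕ) hb
  rw [map_add] at hda hdb hea heb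
  refine (hasWalkPairLE_of_disjoint hG (a := a') (b := b') (fun i => ?_) ?_ ?_ ?_).mono
    (le_add_self.trans ha.ge) (le_add_self.trans hb.ge)
  · have h1 := DFunLike.congr_fun ha i
    have h2 := DFunLike.congr_fun hb i
    simp only [Finsupp.add_apply, Finsupp.inf_apply] at h1 h2
    omega
  · exact add_left_cancel (hda.symm.trans (hdeg.trans hdb))
  · exact add_left_cancel (hea.symm.trans (hedge.trans heb))
  · rintro rfl
    exact hne (ha.trans hb.symm)

end Conformal

end BipartiteRees

namespace BipartiteRees

open SimpleGraph Finsupp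

/-! ### The walk binomials are circuits -/

section Circuit

variable {V : Type u} {G : SimpleGraph V}

/-- The inclusion of the exponent vectors in the integral vectors. -/
noncomputable def toInt {σ : Type*} : (σ →₀ ℕ) →+ (σ →₀ ℤ) :=
  mapRange.addMonoidHom (Nat.castAddMonoidHom ℤ)

@[simp] theorem toInt_apply {σ : Type*} (a : σ →₀ ℕ) (i : σ) : toInt a i = a i := by
  simp [toInt]

@[simp] theorem toInt_single {σ : Type*} (i : σ) (n : ℕ) :
    toInt (single i n) = single i (n : ℤ) := by
  simp [toInt]

theorem vertexDegree_toInt (a : V ⊕ G.edgeSet →₀ ℕ) :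
    vertexDegree G ℤ (toInt a) = toInt (vertexDegree G ℕ a) := by
  induction a using Finsupp.induction_linear with
  | zero => simp
  | add f g hf hg => simp only [map_add, hf, hg]
  | single i n =>
    cases i with
    | inl x => simp
    | inr e =>
      obtain ⟨e, he⟩ := e
      induction e with
      | _ u v =>
        rw [toInt_single, vertexDegree_inr he, vertexDegree_inr he]
        simp

theorem edgeDegree_toInt (a : V ⊕ G.edgeSet →₀ ℕ) :
    edgeDegree G ℤ (toInt a) = edgeDegree G ℕ a := by
  induction a using Finsupp.induction_linear with
  | zero => simp
  | add f g hf hg => simp only [map_add, hf, hg, Nat.cast_add]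
  | single i n => cases i <;> simp

theorem vertexDegree_toInt_walkExp {u v : V} (w : G.Walk u v) :
    (Even w.length → vertexDegree G ℤ (toInt (minusExp w)) - vertexDegree G ℤ (toInt (plusExp w)) =
      single u 1 - single v 1) ∧
    (Odd w.length → vertexDegree G ℤ (toInt (minusExp w)) - vertexDegree G ℤ (toInt (plusExp w)) =
      single u 1 + single v 1) := by
  constructor
  · intro he
    have := congrArg toInt ((vertexDegree_walkExp w).1 he)
    simp only [map_add, toInt_single, Nat.cast_one] at this
    rw [vertexDegree_toInt, vertexDegree_toInt, sub_eq_sub_iff_add_eq_add, add_comm, ← this,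
      add_comm]
  · intro ho
    have := congrArg toInt ((vertexDegree_walkExp w).2 ho)
    simp only [map_add, toInt_single, Nat.cast_one] at this
    rw [vertexDegree_toInt, vertexDegree_toInt, ← this, add_sub_cancel_right]

/-- A vector supported on the edges of a path whose vertex degrees vanish at the inner vertices is
a multiple of the alternating vector of the path. -/
theorem eq_smul_of_supported_edges {u v : V} {w : G.Walk u v} (hw : w.IsPath) :
    ∀ {z : V ⊕ G.edgeSet →₀ ℤ}, (∀ x, z (Sum.inl x) = 0) →
      (∀ e : G.edgeSet, (e : Sym2 V) ∉ w.edges → z (Sum.inr e) = 0) →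
      (∀ x, x ≠ u → x ≠ v → vertexDegree G ℤ z x = 0) →
      z = vertexDegree G ℤ z u • (toInt (minusExp w) - toInt (plusExp w)) := by
  classical
  induction w with
  | nil =>
    intro z hl hr _
    have : z = 0 := by
      ext i
      cases i with
      | inl x => exact hl x
      | inr e => exact hr e (by simp)
    simp [this]
  | @cons u x v hadj p ih =>
    intro z hl hr hd
    obtain ⟨hp, hup⟩ := (Walk.cons_isPath_iff _ _).1 hw
    set e₀ : V ⊕ G.edgeSet := Sum.inr ⟨s(u, x), hadj⟩ with he₀
    have hz := Finsupp.erase_add_single e₀ z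
    set z' := z.erase e₀ with hz'
    set t := z e₀ with ht
    have hl' : ∀ y, z' (Sum.inl y) = 0 := fun y => by simp [hz', he₀, hl y]
    have hr' : ∀ e : G.edgeSet, (e : Sym2 V) ∉ p.edges → z' (Sum.inr e) = 0 := by
      intro e he
      by_cases h : Sum.inr e = e₀
      · rw [h, hz', Finsupp.erase_same]
      · rw [hz', Finsupp.erase_ne h]
        refine hr e fun hmem => ?_
        rw [Walk.edges_cons, List.mem_cons] at hmem
        rcases hmem with hmem | hmem
        · exact h (congrArg Sum.inr (Subtype.ext hmem))
        · exact he hmem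
    have hdz : vertexDegree G ℤ z = vertexDegree G ℤ z' + (single u t + single x t) := by
      rw [← hz, map_add, he₀, vertexDegree_inr]
    -- Only the first edge of the path touches `u`, so its coefficient `t` is the degree of `z` at
    -- `u`.
    have hu' : vertexDegree G ℤ z' u = 0 :=
      vertexDegree_eq_zero_of_forall (hl' u) fun e he => hr' e fun hmem =>
        hup (Walk.mem_support_of_mem_edges hmem he)
    have htu : vertexDegree G ℤ z u = t := by
      rw [hdz]; simp [hu', hadj.ne]
    have hd' : ∀ y, y ≠ x → y ≠ v → vertexDegree G ℤ z' y = 0 := by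
      intro y hyx hyv
      by_cases hyu : y = u
      · rw [hyu, hu']
      · have := hd y hyu hyv
        rw [hdz] at this
        simpa [hyu, hyx] using this
    have := ih hp hl' hr' hd'
    have hfin : z' = -t • (toInt (minusExp p) - toInt (plusExp p)) := by
      -- At the end `v` no vanishing is assumed, but then `p` is trivial and its alternating vector
      -- is zero.
      by_cases hxv : x = v
      · subst hxv
        obtain rfl := (hp.nil_iff_eq.2 rfl).eq_nil
        simpa using this
      · have hx := hd x hadj.ne' hxv
        rw [hdz] at hx
        have hx' : vertexDegree G ℤ z' x = -t := by
          simp [hadj.ne'] at hx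
          omega
        rwa [hx'] at this
    rw [htu, ← hz, hfin, plusExp_cons, minusExp_cons, map_add, toInt_single]
    have : single e₀ t = t • single e₀ (1 : ℤ) := by simp
    rw [this, he₀]
    push_cast
    module

/-- A relation supported on the edges and the end vertices of a path is a multiple of the relation
of the path. -/
theorem eq_smul_of_supported_path {u v : V} {w : G.Walk u v} (hw : w.IsPath) (h0 : 0 < w.length)
    {z : V ⊕ G.edgeSet →₀ ℤ} (hl : ∀ x, x ≠ u → x ≠ v → z (Sum.inl x) = 0)
    (hr : ∀ e : G.edgeSet, (e : Sym2 V) ∉ w.edges → z (Sum.inr e) = 0)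
    (hd : vertexDegree G ℤ z = 0) :
    (Even w.length → z = z (Sum.inl u) • (toInt (single (Sum.inl u) 1 + plusExp w) -
      toInt (single (Sum.inl v) 1 + minusExp w))) ∧
    (Odd w.length → z = z (Sum.inl u) • (toInt (single (Sum.inl u) 1 + single (Sum.inl v) 1 +
      plusExp w) - toInt (minusExp w))) := by
  classical
  have huv : u ≠ v := fun h => by
    exact h0.ne' (Walk.length_eq_zero_iff.2 (hw.nil_iff_eq.2 h))
  set y := z (Sum.inl u) with hy
  set y' := z (Sum.inl v) with hy'
  set z' := z - single (Sum.inl u) y - single (Sum.inl v) y' with hz'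
  have hdz : vertexDegree G ℤ z' = - single u y - single v y' := by
    rw [hz', map_sub, map_sub, hd]
    simp
  have h := eq_smul_of_supported_edges hw (z := z') ?_ ?_ ?_
  · have hu : vertexDegree G ℤ z' u = -y := by
      rw [hdz]
      simp [huv]
    rw [hu] at h
    have hz : z = single (Sum.inl u) y + single (Sum.inl v) y' +
        -y • (toInt (minusExp w) - toInt (plusExp w)) := by
      rw [← h, hz']; abel
    -- Evaluated at `v`, this determines the second end coefficient: `-y` for an even path and `y`
    -- for an odd one.
    have hdz' := congrArg (vertexDegree G ℤ) hz
    rw [hd, map_add, map_add, map_smul, map_sub, vertexDegree_inl, vertexDegree_inl] at hdz'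
    have hsy : (single (Sum.inl u) y : V ⊕ G.edgeSet →₀ ℤ) = y • single (Sum.inl u) 1 := by simp
    have hsy' : (single (Sum.inl v) y' : V ⊕ G.edgeSet →₀ ℤ) = y' • single (Sum.inl v) 1 := by simp
    constructor
    · intro he
      rw [(vertexDegree_toInt_walkExp w).1 he] at hdz'
      have hv := DFunLike.congr_fun hdz' v
      simp [huv] at hv
      have : y' = -y := by omega
      rw [hz, hsy, hsy', this]
      simp only [map_add, toInt_single, Nat.cast_one]
      module
    · intro ho
      rw [(vertexDegree_toInt_walkExp w).2 ho] at hdz'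
      have hv := DFunLike.congr_fun hdz' v
      simp [huv] at hv
      have : y' = y := by omega
      rw [hz, hsy, hsy', this]
      simp only [map_add, toInt_single, Nat.cast_one]
      module
  · intro x
    by_cases hxu : x = u
    · subst hxu
      simp [hz', huv, hy]
    · by_cases hxv : x = v
      · subst hxv
        simp [hz', hxu, hy']
      · simp [hz', hxu, hxv, hl x hxu hxv]
  · intro e he
    simp [hz', hr e he]
  · intro x hxu hxv
    rw [hdz]
    simp [hxu, hxv]

/-- The circuit property, with an integral multiple. A cycle is cut open at its first edge; a
relation on a pair splits along the two paths, each part being determined up to a multiple. -/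
theorem IsWalkPair.exists_eq_smul {c d : V ⊕ G.edgeSet →₀ ℕ} (h : IsWalkPair G c d)
    {z : V ⊕ G.edgeSet →₀ ℤ} (hz : ∀ i, c i = 0 → d i = 0 → z i = 0)
    (hd : vertexDegree G ℤ z = 0) (he : edgeDegree G ℤ z = 0) :
    ∃ k : ℤ, z = k • (toInt c - toInt d) := by
  classical
  have hedge : ∀ {u v : V} (w : G.Walk u v) (e : G.edgeSet), (e : Sym2 V) ∉ w.edges →
      plusExp w (Sum.inr e) = 0 ∧ minusExp w (Sum.inr e) = 0 := by
    intro u v w e hw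
    rw [mem_edges_iff_walkExp] at hw
    omega
  cases h with
  | @cycle u w hw hev =>
    cases w with
    | nil => simp at hw
    | @cons _ x _ hadj p =>
      obtain ⟨hp, hup⟩ := (Walk.cons_isCycle_iff _ _).1 hw
      set e₀ : V ⊕ G.edgeSet := Sum.inr ⟨s(u, x), hadj⟩ with he₀
      have hsum := Finsupp.erase_add_single e₀ z
      set z' := z.erase e₀ with hz'
      set t := z e₀ with ht
      have hdz : vertexDegree G ℤ z' = - (single u t + single x t) := by
        have := hd
        rw [← hsum, map_add, he₀, vertexDegree_inr] at this
        exact eq_neg_of_add_eq_zero_left this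
      have h1 := eq_smul_of_supported_edges hp (z := z') ?_ ?_ ?_
      · have hx : vertexDegree G ℤ z' x = -t := by
          rw [hdz]; simp [hadj.ne']
        rw [hx] at h1
        refine ⟨-t, ?_⟩
        rw [← hsum, h1, plusExp_cons, minusExp_cons, map_add, toInt_single]
        have : single e₀ t = t • single e₀ (1 : ℤ) := by simp
        rw [this, he₀]
        push_cast
        module
      · intro y
        rw [hz', Finsupp.erase_ne (by simp [he₀])]
        exact hz _ (walkExp_inl _ y).1 (walkExp_inl _ y).2
      · intro e hep
        by_cases h : Sum.inr e = e₀
        · rw [h, hz', Finsupp.erase_same]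
        · rw [hz', Finsupp.erase_ne h]
          have := hedge (.cons hadj p) e (by
            rw [Walk.edges_cons, List.mem_cons, not_or]
            exact ⟨fun h' => h (congrArg Sum.inr (Subtype.ext h')), hep⟩)
          exact hz _ this.1 this.2
      · intro y hyx hyu
        rw [hdz]
        simp [hyx, hyu]
  | @path u v w hw hev h0 =>
    refine ⟨_, (eq_smul_of_supported_path hw h0 ?_ ?_ hd).1 hev⟩
    · intro x hxu hxv
      exact hz _ (by simp [hxu]) (by simp [hxv])
    · intro e hew
      exact hz _ (by simp [hedge w e hew]) (by simp [hedge w e hew])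
  | @pair u₀ u₁ v₀ v₁ w₁ w₂ hw₁ ho₁ hw₂ ho₂ hdis =>
    let z₁ : V ⊕ G.edgeSet →₀ ℤ :=
      z.filter (Sum.elim (fun x => x ∈ w₁.support) fun e => (e : Sym2 V) ∈ w₁.edges)
    have h1l : ∀ x, z₁ (Sum.inl x) = if x ∈ w₁.support then z (Sum.inl x) else 0 :=
      fun x => by simp only [z₁, Finsupp.filter_apply, Sum.elim_inl]; congr
    have h1r : ∀ e : G.edgeSet,
        z₁ (Sum.inr e) = if (e : Sym2 V) ∈ w₁.edges then z (Sum.inr e) else 0 :=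
      fun e => by simp only [z₁, Finsupp.filter_apply, Sum.elim_inr]; congr
    obtain ⟨z₂, hz₂⟩ : ∃ z₂, z₂ = z - z₁ := ⟨_, rfl⟩
    have hzl : ∀ x, x ≠ u₀ → x ≠ u₁ → x ≠ v₀ → x ≠ v₁ → z (Sum.inl x) = 0 := by
      intro x h1 h2 h3 h4
      exact hz _ (by simp [h1, h2]) (by simp [h3, h4])
    have hzr : ∀ e : G.edgeSet, (e : Sym2 V) ∉ w₁.edges → (e : Sym2 V) ∉ w₂.edges →
        z (Sum.inr e) = 0 := by
      intro e h1 h2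
      exact hz _ (by simp [hedge w₁ e h1, hedge w₂ e h2]) (by simp [hedge w₁ e h1, hedge w₂ e h2])
    have h2l : ∀ x, x ≠ v₀ → x ≠ v₁ → z₂ (Sum.inl x) = 0 := by
      intro x h3 h4
      rw [hz₂, Finsupp.sub_apply, h1l]
      split_ifs with hx
      · simp
      · rw [hzl x (fun h => hx (h ▸ w₁.start_mem_support)) (fun h => hx (h ▸ w₁.end_mem_support))
          h3 h4]
        simp
    have h2r : ∀ e : G.edgeSet, (e : Sym2 V) ∉ w₂.edges → z₂ (Sum.inr e) = 0 := by
      intro e h2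
      rw [hz₂, Finsupp.sub_apply, h1r]
      split_ifs with hx
      · simp
      · simp [hzr e hx h2]
    have h1l' : ∀ x, x ≠ u₀ → x ≠ u₁ → z₁ (Sum.inl x) = 0 := by
      intro x h1 h2
      rw [h1l]
      split_ifs with hx
      · refine hzl x h1 h2 ?_ ?_
        · rintro rfl
          exact hdis hx w₂.start_mem_support
        · rintro rfl
          exact hdis hx w₂.end_mem_support
      · rfl
    have h1r' : ∀ e : G.edgeSet, (e : Sym2 V) ∉ w₁.edges → z₁ (Sum.inr e) = 0 := by
      intro e h1
      rw [h1r, if_neg h1]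
    have hsum : vertexDegree G ℤ z₁ + vertexDegree G ℤ z₂ = 0 := by
      rw [hz₂, map_sub, hd]; simp
    have hoff : ∀ x, x ∉ w₁.support → vertexDegree G ℤ z₁ x = 0 := fun x hx =>
      vertexDegree_eq_zero_of_forall (by rw [h1l, if_neg hx]) fun e hxe =>
        h1r' e fun hmem => hx (Walk.mem_support_of_mem_edges hmem hxe)
    -- By disjointness `z₂` contributes nothing at the vertices of `w₁`, and `z₁` contributes
    -- nothing elsewhere.
    have hd₁ : vertexDegree G ℤ z₁ = 0 := by
      ext x
      by_cases hx : x ∈ w₁.support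
      · have hx2 : x ∉ w₂.support := fun h => hdis hx h
        have := DFunLike.congr_fun hsum x
        rw [Finsupp.add_apply, vertexDegree_eq_zero_of_forall (z := z₂)
          (h2l x (fun h => hx2 (h ▸ w₂.start_mem_support)) (fun h => hx2 (h ▸ w₂.end_mem_support)))
          (fun e hxe => h2r e fun hmem => hx2 (Walk.mem_support_of_mem_edges hmem hxe)),
          add_zero] at this
        exact this
      · exact hoff x hx
    have hd₂ : vertexDegree G ℤ z₂ = 0 := by rwa [hd₁, zero_add] at hsum
    have e1 := (eq_smul_of_supported_path hw₁ ho₁.pos h1l' h1r' hd₁).2 ho₁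
    have e2 := (eq_smul_of_supported_path hw₂ ho₂.pos h2l h2r hd₂).2 ho₂
    have htot : z = z₁ + z₂ := by rw [hz₂]; abel
    generalize z₁ (Sum.inl u₀) = k₁ at e1
    generalize z₂ (Sum.inl v₀) = k₂ at e2
    rw [e1, e2] at htot
    -- The vector of each odd path has edge degree `-1`, so vanishing of the total edge degree
    -- forces opposite multiples.
    have hk : k₁ + k₂ = 0 := by
      rw [htot] at he
      simp only [map_add, map_smul, map_sub, edgeDegree_toInt, toInt_single, edgeDegree_inl,
        ← (edgeDegree_walkExp w₁).2 ho₁, ← (edgeDegree_walkExp w₂).2 ho₂, smul_eq_mul] at he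
      push_cast at he
      linarith
    refine ⟨k₁, ?_⟩
    rw [htot, eq_neg_of_add_eq_zero_right hk]
    simp only [map_add]
    module

theorem IsWalkPair.exists_sub_eq {c d : V ⊕ G.edgeSet →₀ ℕ} (h : IsWalkPair G c d)
    {a b : V ⊕ G.edgeSet →₀ ℕ} (ha : ∀ i, c i = 0 → d i = 0 → a i = 0)
    (hb : ∀ i, c i = 0 → d i = 0 → b i = 0)
    (hd : vertexDegree G ℕ a = vertexDegree G ℕ b) (he : edgeDegree G ℕ a = edgeDegree G ℕ b) :
    ∃ k : ℤ, ∀ i, (a i : ℤ) - b i = k * ((c i : ℤ) - d i) := by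
  obtain ⟨k, hk⟩ := h.exists_eq_smul (z := toInt a - toInt b)
    (fun i hc hd => by simp [ha i hc hd, hb i hc hd])
    (by rw [map_sub, vertexDegree_toInt, vertexDegree_toInt, hd, sub_self])
    (by rw [map_sub, edgeDegree_toInt, edgeDegree_toInt, he, sub_self])
  exact ⟨k, fun i => by simpa using DFunLike.congr_fun hk i⟩

theorem IsWalkPair.disjoint {c d : V ⊕ G.edgeSet →₀ ℕ} (h : IsWalkPair G c d)
    (i : V ⊕ G.edgeSet) : c i = 0 ∨ d i = 0 := by
  cases h with
  | cycle w hw hev =>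
    have := walkExp_apply_le_one hw.isTrail i
    omega
  | @path u v w hw hev h0 =>
    have huv : u ≠ v := fun h => by
      exact h0.ne' (Walk.length_eq_zero_iff.2 (hw.nil_iff_eq.2 h))
    cases i with
    | inl x =>
      by_cases hx : u = x
      · subst hx; simp [huv.symm]
      · simp [hx]
    | inr e =>
      have := walkExp_apply_le_one hw.isTrail (Sum.inr e)
      simp only [Finsupp.add_apply, ne_eq, reduceCtorEq, not_false_eq_true,
        Finsupp.single_eq_of_ne]
      omega
  | @pair u₀ u₁ v₀ v₁ w₁ w₂ hw₁ ho₁ hw₂ ho₂ hdis =>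
    cases i with
    | inl x =>
      by_cases hx : x ∈ w₁.support
      · right
        have h0 : v₀ ≠ x := fun h => hdis hx (h ▸ w₂.start_mem_support)
        have h1 : v₁ ≠ x := fun h => hdis hx (h ▸ w₂.end_mem_support)
        simp [h0, h1]
      · left
        have h0 : u₀ ≠ x := fun h => hx (h ▸ w₁.start_mem_support)
        have h1 : u₁ ≠ x := fun h => hx (h ▸ w₁.end_mem_support)
        simp [h0, h1]
    | inr e =>
      have hdisj : ¬ ((0 < plusExp w₁ (Sum.inr e) ∨ 0 < minusExp w₁ (Sum.inr e)) ∧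
          (0 < plusExp w₂ (Sum.inr e) ∨ 0 < minusExp w₂ (Sum.inr e))) := by
        rintro ⟨hl, hr⟩
        obtain ⟨x, hx⟩ : ∃ x, x ∈ (e : Sym2 V) := ⟨_, Sym2.out_fst_mem _⟩
        exact hdis (mem_support_of_walkExp w₁ hl hx) (mem_support_of_walkExp w₂ hr hx)
      have := walkExp_apply_le_one hw₁.isTrail (Sum.inr e)
      have := walkExp_apply_le_one hw₂.isTrail (Sum.inr e)
      simp only [Finsupp.add_apply, ne_eq, reduceCtorEq, not_false_eq_true,
        Finsupp.single_eq_of_ne]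
      omega

theorem IsWalkPair.left_ne_zero {c d : V ⊕ G.edgeSet →₀ ℕ} (h : IsWalkPair G c d) : c ≠ 0 := by
  rintro rfl
  -- For a cycle the visible variable, its first edge, lies in `d`; equality of degrees carries the
  -- vanishing over from `c`.
  have hd := eq_zero_of_vertexDegree_eq_zero (h.vertexDegree_eq.symm.trans (map_zero _))
  generalize hc : (0 : V ⊕ G.edgeSet →₀ ℕ) = c at h
  cases h with
  | @cycle u w hw hev =>
    cases w with
    | nil => simp at hw
    | @cons _ x _ hadj p =>
      have := DFunLike.congr_fun hd (Sum.inr ⟨s(u, x), hadj⟩)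
      simp at this
  | @path u v w hw hev h0 =>
    have := DFunLike.congr_fun hc (Sum.inl u)
    simp at this
  | @pair u₀ u₁ v₀ v₁ w₁ w₂ hw₁ ho₁ hw₂ ho₂ hdis =>
    have := DFunLike.congr_fun hc (Sum.inl u₀)
    simp only [Finsupp.add_apply, Finsupp.single_eq_same, Finsupp.zero_apply] at this
    omega

theorem IsWalkPair.ne {c d : V ⊕ G.edgeSet →₀ ℕ} (h : IsWalkPair G c d) : c ≠ d := by
  rintro rfl
  refine h.left_ne_zero ?_
  ext i
  simpa using h.disjoint i

end Circuit

end BipartiteRees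

namespace BipartiteRees

open Finsupp MvPolynomial
open scoped MonomialOrder

/-! ### Reduced Gröbner bases of toric ideals -/

section Toric

variable {σ : Type u} {K : Type*} [Field K] {T : Type*} [AddCommMonoid T]

/-- `J` is spanned by the binomials whose two terms have the same image under `π`, in the form of
the two properties that are used. -/
structure IsToric (π : (σ →₀ ℕ) →+ T) (J : Ideal (MvPolynomial σ K)) : Prop where
  binomial_mem : ∀ a b, π a = π b → monomial a (1 : K) - monomial b 1 ∈ J
  exists_ne : ∀ f ∈ J, ∀ a ∈ f.support, ∃ b ∈ f.support, b ≠ a ∧ π b = π a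

/-- The monomial of exponent `a` is not the smallest one of its fibre. -/
def Nonstandard (m : MonomialOrder.{u, u} σ) (π : (σ →₀ ℕ) →+ T) (a : σ →₀ ℕ) : Prop :=
  ∃ b, π b = π a ∧ b ≺[m] a

variable {m : MonomialOrder.{u, u} σ} {π : (σ →₀ ℕ) →+ T} {J : Ideal (MvPolynomial σ K)}

theorem Nonstandard.mono {a a' : σ →₀ ℕ} (h : Nonstandard m π a) (ha : a ≤ a') :
    Nonstandard m π a' := by
  obtain ⟨b, hb, hlt⟩ := h
  obtain ⟨c, rfl⟩ := exists_add_of_le ha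
  exact ⟨b + c, by rw [map_add, map_add, hb], by rw [map_add, map_add]; gcongr⟩

/-- The leading monomial has a companion in its fibre within `f`, necessarily smaller. Thus no
nonzero element of `J` has only standard monomials. -/
theorem IsToric.nonstandard_degree (hJ : IsToric π J) {f : MvPolynomial σ K} (hf : f ∈ J)
    (h0 : f ≠ 0) : Nonstandard m π (m.degree f) := by
  obtain ⟨b, hb, hne, hπ⟩ := hJ.exists_ne f hf _ (m.degree_mem_support h0)
  exact ⟨b, hπ, (m.le_degree hb).lt_of_ne fun h => hne (m.toSyn.injective h)⟩

theorem degree_binomial {a b : σ →₀ ℕ} (h : b ≺[m] a) :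
    m.degree (monomial a (1 : K) - monomial b 1) = a := by
  classical
  rw [m.degree_sub_of_lt] <;> simp [m.degree_monomial, h]

theorem monic_binomial {a b : σ →₀ ℕ} (h : b ≺[m] a) :
    m.Monic (monomial a (1 : K) - monomial b 1) := by
  classical
  rw [MonomialOrder.Monic, m.leadingCoeff_sub_of_lt] <;> simp [m.degree_monomial, h]

theorem eq_or_eq_of_mem_support_binomial {a b s : σ →₀ ℕ}
    (hs : s ∈ (monomial a (1 : K) - monomial b 1).support) : s = a ∨ s = b := by
  classical
  by_contra! hcon
  rw [MvPolynomial.mem_support_iff, coeff_sub, coeff_monomial, coeff_monomial, if_neg hcon.1.symm,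
    if_neg hcon.2.symm] at hs
  simp at hs

theorem leadingTerm_of_monic {f : MvPolynomial σ K} (hf : m.Monic f) :
    m.leadingTerm f = monomial (m.degree f) 1 := by
  rw [MonomialOrder.leadingTerm, hf.leadingCoeff_eq_one]

/-- `x^a - x^b` is the element of the reduced Gröbner basis with the leading exponent `a`. -/
structure IsReducedBinomial (m : MonomialOrder.{u, u} σ) (π : (σ →₀ ℕ) →+ T)
    (a b : σ →₀ ℕ) : Prop where
  map_eq : π b = π a
  lt : b ≺[m] a
  standard : ¬ Nonstandard m π b
  minimal : ∀ s, Nonstandard m π s → s ≤ a → s = a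

/-- The basis consists of the minimal nonstandard monomials, each minus the smallest monomial of its
fibre. -/
theorem IsToric.exists_isReducedGroebnerBasis [Finite σ] (hJ : IsToric π J)
    (m : MonomialOrder.{u, u} σ) :
    ∃ B, IsReducedGroebnerBasis m J B ∧
      ∀ a b, IsReducedBinomial m π a b → monomial a (1 : K) - monomial b 1 ∈ B := by
  let B : Set (MvPolynomial σ K) :=
    {f | ∃ a b, IsReducedBinomial m π a b ∧ f = monomial a (1 : K) - monomial b 1}
  have huniq : ∀ {a b b'}, IsReducedBinomial m π a b → IsReducedBinomial m π a b' → b = b' := by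
    intro a b b' h h'
    by_contra hne
    rcases lt_or_gt_of_ne (fun h => hne (m.toSyn.injective h)) with hlt | hlt
    · exact h'.standard ⟨b, h.map_eq.trans h'.map_eq.symm, hlt⟩
    · exact h.standard ⟨b', h'.map_eq.trans h.map_eq.symm, hlt⟩
  have hJB : B ⊆ (J : Set (MvPolynomial σ K)) := by
    rintro f ⟨a, b, h, rfl⟩
    exact hJ.binomial_mem _ _ h.map_eq.symm
  refine ⟨B, ⟨?_, hJB, ?_, ?_, ?_⟩, fun a b h => ⟨a, b, h, rfl⟩⟩
  · refine Set.Finite.of_finite_image (f := m.degree) ?_ ?_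
    -- Dickson's lemma: by minimality the leading exponents form an antichain.
    · refine IsAntichain.finite_of_wellQuasiOrdered (r := (· ≤ ·)) ?_ wellQuasiOrdered_le
      rintro _ ⟨_, ⟨a, b, h, rfl⟩, rfl⟩ _ ⟨_, ⟨a', b', h', rfl⟩, rfl⟩ hne hle
      rw [degree_binomial h.lt, degree_binomial h'.lt] at *
      exact hne (h'.minimal a ⟨b, h.map_eq, h.lt⟩ hle)
    · rintro _ ⟨a, b, h, rfl⟩ _ ⟨a', b', h', rfl⟩ heq
      rw [degree_binomial h.lt, degree_binomial h'.lt] at heq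
      subst heq
      rw [huniq h h']
  · refine le_antisymm (Ideal.span_mono (Set.image_mono hJB)) (Ideal.span_le.2 ?_)
    rintro _ ⟨f, hf, rfl⟩
    by_cases h0 : f = 0
    · subst h0
      rw [m.leadingTerm_zero]
      exact Ideal.zero_mem _
    have hns := hJ.nonstandard_degree (m := m) hf h0
    obtain ⟨a, ⟨hale, ha⟩, hamin⟩ := (inferInstance : IsWellFounded (σ →₀ ℕ) (· < ·)).wf.has_min
      {a | a ≤ m.degree f ∧ Nonstandard m π a} ⟨_, le_rfl, hns⟩
    obtain ⟨b, hb, hbmin⟩ := (InvImage.wf m.toSyn wellFounded_lt).has_min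
      {b | π b = π a ∧ b ≺[m] a} ha
    have hab : IsReducedBinomial m π a b := by
      refine ⟨hb.1, hb.2, ?_, ?_⟩
      · rintro ⟨c, hc, hlt⟩
        exact hbmin c ⟨hc.trans hb.1, hlt.trans hb.2⟩ hlt
      · intro s hs hsa
        by_contra hne
        exact hamin s ⟨hsa.trans hale, hs⟩ (lt_of_le_of_ne hsa hne)
    have hmem : m.leadingTerm (monomial a (1 : K) - monomial b 1) ∈ Ideal.span (m.leadingTerm '' B) :=
      Ideal.subset_span ⟨_, ⟨a, b, hab, rfl⟩, rfl⟩
    rw [leadingTerm_of_monic (monic_binomial hb.2), degree_binomial hb.2] at hmem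
    obtain ⟨c, hc⟩ := exists_add_of_le hale
    rw [SetLike.mem_coe, MonomialOrder.leadingTerm, hc,
      show monomial (a + c) (m.leadingCoeff f) = monomial c (m.leadingCoeff f) * monomial a 1 by
        rw [monomial_mul, mul_one, add_comm]]
    exact Ideal.mul_mem_left _ _ hmem
  · rintro _ ⟨a, b, h, rfl⟩
    exact monic_binomial h.lt
  · rintro _ ⟨a, b, h, rfl⟩ _ ⟨a', b', h', rfl⟩ hne s hs hle
    rw [degree_binomial h'.lt] at hle
    have hns : Nonstandard m π a' := ⟨b', h'.map_eq, h'.lt⟩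
    rcases eq_or_eq_of_mem_support_binomial hs with rfl | rfl
    · obtain rfl := h.minimal _ hns hle
      rw [huniq h h'] at hne
      exact hne rfl
    · exact h.standard (hns.mono hle)

theorem IsToric.exists_degree_le (hJ : IsToric π J) {B : Set (MvPolynomial σ K)}
    (hB : IsReducedGroebnerBasis m J B) {s : σ →₀ ℕ} (hs : Nonstandard m π s) :
    ∃ h ∈ B, m.degree h ≤ s := by
  obtain ⟨t, ht, hlt⟩ := hs
  have hmem : m.leadingTerm (monomial s (1 : K) - monomial t 1) ∈
      Ideal.span (m.leadingTerm '' B) := by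
    rw [hB.span_leadingTerm]
    exact Ideal.subset_span ⟨_, hJ.binomial_mem _ _ ht.symm, rfl⟩
  have himg : m.leadingTerm '' B = (fun a => monomial a (1 : K)) '' (m.degree '' B) := by
    rw [Set.image_image]
    exact Set.image_congr fun f hf => leadingTerm_of_monic (hB.monic f hf)
  classical
  rw [leadingTerm_of_monic (monic_binomial hlt), degree_binomial hlt, himg,
    mem_ideal_span_monomial_image] at hmem
  obtain ⟨_, ⟨h, hh, rfl⟩, hle⟩ :=
    hmem s (by rw [MvPolynomial.mem_support_iff, coeff_monomial, if_pos rfl]; exact one_ne_zero)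
  exact ⟨h, hh, hle⟩

/-- Reducedness makes every monomial of `f` except the leading one standard, and a second monomial
`b` of the leading fibre is available in `f`. -/
theorem IsToric.exists_eq_binomial (hJ : IsToric π J) {B : Set (MvPolynomial σ K)}
    (hB : IsReducedGroebnerBasis m J B) {f : MvPolynomial σ K} (hf : f ∈ B) :
    ∃ a b, IsReducedBinomial m π a b ∧ f = monomial a 1 - monomial b 1 := by
  classical
  have hmonic := hB.monic f hf
  have hsupp := m.degree_mem_support hmonic.ne_zero
  obtain ⟨b, hb, hne, hπ⟩ := hJ.exists_ne f (hB.subset hf) _ hsupp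
  have hlt : b ≺[m] m.degree f := (m.le_degree hb).lt_of_ne fun h => hne (m.toSyn.injective h)
  have hdiv : ∀ s ∈ f.support, Nonstandard m π s → m.degree f ≤ s := by
    intro s hs hns
    obtain ⟨h, hh, hle⟩ := hJ.exists_degree_le hB hns
    by_cases hhf : h = f
    · rwa [hhf] at hle
    · exact absurd hle (hB.reduced f hf h hh hhf s hs)
  have hstd : ∀ s ∈ f.support, s ≠ m.degree f → ¬ Nonstandard m π s := by
    intro s hs hsne hns
    exact hsne (m.toSyn.injective (le_antisymm (m.le_degree hs) (m.toSyn_monotone (hdiv s hs hns))))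
  refine ⟨m.degree f, b, ⟨hπ, hlt, hstd b hb hne, ?_⟩, ?_⟩
  · intro s hs hle
    obtain ⟨h, hh, hhle⟩ := hJ.exists_degree_le hB hs
    by_cases hhf : h = f
    · rw [hhf] at hhle
      exact le_antisymm hle hhle
    · exact absurd (hhle.trans hle) (hB.reduced f hf h hh hhf _ hsupp)
  · by_contra hcon
    -- The leading monomials cancel, so this element of `J` has only standard monomials and must
    -- vanish.
    have hg : f - (monomial (m.degree f) 1 - monomial b 1) ∈ J :=
      J.sub_mem (hB.subset hf) (hJ.binomial_mem _ _ hπ.symm)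
    have hg0 := sub_ne_zero.2 hcon
    have hns := hJ.nonstandard_degree (m := m) hg hg0
    have hmem := m.degree_mem_support hg0
    generalize m.degree (f - (monomial (m.degree f) 1 - monomial b 1)) = c at hns hmem
    have hca : c ≠ m.degree f := by
      rintro rfl
      rw [MvPolynomial.mem_support_iff, coeff_sub, coeff_sub, hmonic.coeff_degree, coeff_monomial,
        coeff_monomial, if_pos rfl, if_neg hne] at hmem
      simp at hmem
    by_cases hcf : c ∈ f.support
    · exact hstd c hcf hca hns
    · have hcb : c ≠ b := by
        rintro rfl
        exact hcf hb
      rw [MvPolynomial.mem_support_iff, coeff_sub, coeff_sub, MvPolynomial.notMem_support_iff.1 hcf,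
        coeff_monomial, coeff_monomial, if_neg hca.symm, if_neg hcb.symm] at hmem
      simp at hmem

end Toric

/-! ### An elimination order -/

/-- A monomial order for which every variable outside `S` is larger than every monomial in the
variables of `S`, and `i₀` is the largest variable of `S`. -/
theorem exists_eliminationOrder {σ : Type u} [Finite σ] (S : Set σ) (i₀ : σ) :
    ∃ m : MonomialOrder.{u, u} σ,
      (∀ a b : σ →₀ ℕ, b ≺[m] a → (∀ i ∉ S, a i = 0) → ∀ i ∉ S, b i = 0) ∧
      ∀ c d : σ →₀ ℕ, (∀ i ∉ S, c i = 0) → (∀ i ∉ S, d i = 0) → d i₀ < c i₀ → d ≺[m] c := by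
  classical
  obtain ⟨n, ⟨e⟩⟩ := Finite.exists_equiv_fin σ
  -- In `MonomialOrder.lex` smaller indices are larger variables; the ranks put the outside
  -- variables first, then `i₀`, then the rest, with ties broken by an arbitrary enumeration.
  let r : σ → ℕ := fun i => if i ∉ S then 0 else if i = i₀ then 1 else 2
  let φ : σ → ℕ ×ₗ Fin n := fun i => toLex (r i, e i)
  have hφ : Function.Injective φ := fun i j h => e.injective (Prod.ext_iff.1 (toLex.injective h)).2
  let _ : LinearOrder σ := LinearOrder.lift' φ hφ
  have hr : ∀ i j, r i < r j → i < j := fun i j h => by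
    change φ i < φ j
    exact Prod.Lex.toLex_lt_toLex.2 (.inl h)
  refine ⟨MonomialOrder.lex, fun a b hlt ha => ?_, fun c d hc hd h => ?_⟩
  · rw [MonomialOrder.lex_lt_iff, Finsupp.Lex.lt_iff] at hlt
    obtain ⟨j, hj, hjlt⟩ := hlt
    have hjS : j ∈ S := by
      by_contra hjS
      have := ha j hjS
      simp only [ofLex_toLex] at hjlt
      omega
    intro i hi
    have hij : i < j := hr i j (by simp only [r, hi, hjS, not_true, not_false_eq_true, if_true, if_false]; split_ifs <;> omega)
    rw [← ha i hi]
    exact hj i hij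
  · rw [MonomialOrder.lex_lt_iff, Finsupp.Lex.lt_iff]
    by_cases hi₀ : i₀ ∈ S
    · refine ⟨i₀, fun i hi => ?_, h⟩
      have hiS : i ∉ S := by
        intro hiS
        refine lt_asymm hi (hr _ _ ?_)
        simp [r, hiS, hi₀, hi.ne]
      simp only [ofLex_toLex]
      rw [hc i hiS, hd i hiS]
    · rw [hc i₀ hi₀] at h
      simp at h

/-! ### The Rees ideal is toric -/

section Kernel

variable {V : Type u} {G : SimpleGraph V}

/-- The bidegree of the image of a monomial in the Rees algebra. -/
noncomputable def reesDegree (G : SimpleGraph V) :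
    (V ⊕ G.edgeSet →₀ ℕ) →+ (V →₀ ℕ) × ℕ :=
  (vertexDegree G ℕ).toAddMonoidHom.prod (edgeDegree G ℕ).toAddMonoidHom

theorem reesDegree_apply (a : V ⊕ G.edgeSet →₀ ℕ) :
    reesDegree G a = (vertexDegree G ℕ a, edgeDegree G ℕ a) := rfl

variable (K : Type*) [Field K]

theorem coe_reesMap_monomial (a : V ⊕ G.edgeSet →₀ ℕ) (r : K) :
    (reesMap K G (monomial a r) : Polynomial (MvPolynomial V K)) =
      Polynomial.monomial (edgeDegree G ℕ a) (monomial (vertexDegree G ℕ a) r) := by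
  have hmul : ∀ a b : V ⊕ G.edgeSet →₀ ℕ,
      (monomial (a + b) (1 : K)) = monomial a 1 * monomial b 1 := fun a b => by
    rw [monomial_mul, one_mul]
  have h1 : (reesMap K G (monomial a 1) : Polynomial (MvPolynomial V K)) =
      Polynomial.monomial (edgeDegree G ℕ a) (monomial (vertexDegree G ℕ a) 1) := by
    induction a using Finsupp.induction_linear with
    | zero =>
      rw [monomial_zero', map_one, map_one, map_zero, map_zero]
      rfl
    | add f g hf hg =>
      rw [hmul, map_mul, MulMemClass.coe_mul, hf, hg, Polynomial.monomial_mul_monomial,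
        monomial_mul, one_mul, map_add, map_add]
    | single i n =>
      rw [← X_pow_eq_monomial, map_pow, SubmonoidClass.coe_pow, reesMap, aeval_X]
      cases i with
      | inl v =>
        simp only [Sum.elim_inl, Subalgebra.coe_algebraMap, Polynomial.algebraMap_eq,
          edgeDegree_inl, vertexDegree_inl, Polynomial.monomial_zero_left]
        rw [← map_pow, X_pow_eq_monomial]
      | inr e =>
        obtain ⟨e, he⟩ := e
        induction e with
        | _ u v =>
          rw [vertexDegree_inr he, edgeDegree_inr, Sum.elim_inr, Polynomial.monomial_pow, one_mul]
          congr 1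
          change (X u * X v) ^ n = _
          rw [mul_pow, X_pow_eq_monomial, X_pow_eq_monomial, monomial_mul, one_mul]
  have hr : (monomial a r : MvPolynomial (V ⊕ G.edgeSet) K) = r • monomial a 1 := by
    rw [smul_monomial, smul_eq_mul, mul_one]
  rw [hr, map_smul]
  change r • (reesMap K G (monomial a 1) : Polynomial (MvPolynomial V K)) = _
  rw [h1, Polynomial.smul_monomial, smul_monomial, smul_eq_mul, mul_one]

/-- Monomials map to monomials determined by the bidegree, so a term of a kernel element can be
cancelled only by another term of the same bidegree. -/
theorem isToric_reesIdeal : IsToric (reesDegree G) (reesIdeal K G) where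
  binomial_mem a b h := by
    rw [reesDegree_apply, reesDegree_apply, Prod.mk.injEq] at h
    rw [reesIdeal, RingHom.mem_ker, map_sub, sub_eq_zero]
    refine Subtype.ext ?_
    erw [coe_reesMap_monomial, coe_reesMap_monomial]
    rw [h.1, h.2]
  exists_ne f hf a ha := by
    classical
    by_contra! hcon
    rw [reesIdeal, RingHom.mem_ker, f.as_sum, map_sum] at hf
    have h := congrArg (fun p : reesAlgebra (edgeIdeal K G) =>
      ((p : Polynomial (MvPolynomial V K)).coeff (edgeDegree G ℕ a)).coeff (vertexDegree G ℕ a)) hf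
    simp only [AddSubmonoidClass.coe_finsetSum, ZeroMemClass.coe_zero, Polynomial.coeff_zero,
      coeff_zero, Polynomial.finsetSum_coeff, coeff_sum] at h
    rw [Finset.sum_eq_single a] at h
    · erw [coe_reesMap_monomial] at h
      simp at h
      exact MvPolynomial.mem_support_iff.1 ha h
    · intro b hb hba
      erw [coe_reesMap_monomial]
      rw [Polynomial.coeff_monomial]
      split_ifs with h1
      · rw [coeff_monomial, if_neg]
        intro h2
        exact hcon b hb hba (by rw [reesDegree_apply, reesDegree_apply, h1, h2])
      · simp
    · intro h
      exact absurd ha h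

/-- Links the products over edge numbers with the recursive exponents: splitting off the factor at
index 0 shifts the rest and exchanges the two products. -/
theorem walkPlus_eq_and_walkMinus_eq {u v : V} (w : G.Walk u v) :
    walkPlus K w = monomial (plusExp w) 1 ∧ walkMinus K w = monomial (minusExp w) 1 := by
  induction w with
  | nil =>
    exact ⟨Finset.prod_eq_one fun i => i.elim0, Finset.prod_eq_one fun i => i.elim0⟩
  | @cons u x v h p ih =>
    have hs : ∀ i : Fin p.length,
        walkEdgeVar K (.cons h p) (Fin.succ i : Fin (p.length + 1)) = walkEdgeVar K p i := fun i => rfl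
    constructor
    · rw [plusExp_cons, ← ih.2, walkPlus, walkMinus, Finset.prod_filter, Finset.prod_filter]
      change ∏ i : Fin (p.length + 1), _ = _
      rw [Fin.prod_univ_succ]
      simp [hs, Nat.even_add_one, Nat.odd_add_one]
    · rw [minusExp_cons, ← one_mul (1 : K), ← monomial_mul, ← ih.1, walkPlus, walkMinus,
        Finset.prod_filter, Finset.prod_filter]
      change ∏ i : Fin (p.length + 1), _ = _
      rw [Fin.prod_univ_succ]
      simp [hs, Nat.even_add_one, Nat.odd_add_one]
      left
      exact congrArg X (congrArg Sum.inr (Subtype.ext (by simp)))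

end Kernel

end BipartiteRees

namespace BipartiteRees

open Finsupp MvPolynomial
open scoped MonomialOrder

/-! ### Both inclusions -/

section Main

variable {V : Type u} {G : SimpleGraph V} {K : Type*} [Field K]

theorem IsWalkPair.reesDegree_eq {c d : V ⊕ G.edgeSet →₀ ℕ} (h : IsWalkPair G c d) :
    reesDegree G c = reesDegree G d :=
  Prod.ext h.vertexDegree_eq h.edgeDegree_eq

theorem exists_isWalkPair_iff (f : ReesRing K G) :
    (∃ c d, IsWalkPair G c d ∧ f = monomial c 1 - monomial d 1) ↔
    f ∈ {f | ∃ (v : V) (w : G.Walk v v), w.IsCycle ∧ Even w.length ∧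
          f = cycleBinomial K w} ∪
      {f | ∃ (v₀ vₐ : V) (w : G.Walk v₀ vₐ), w.IsPath ∧ Even w.length ∧ 0 < w.length ∧
          f = pathBinomial K w} ∪
      {f | ∃ (u₀ uₐ v₀ v_b : V) (w₁ : G.Walk u₀ uₐ) (w₂ : G.Walk v₀ v_b),
          w₁.IsPath ∧ Odd w₁.length ∧ w₂.IsPath ∧ Odd w₂.length ∧
          w₁.support.Disjoint w₂.support ∧
          f = pathPairBinomial K w₁ w₂} := by
  have hcycle : ∀ {v : V} (w : G.Walk v v), cycleBinomial K w =
      monomial (plusExp w) 1 - monomial (minusExp w) 1 := fun w => by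
    rw [cycleBinomial, (walkPlus_eq_and_walkMinus_eq K w).1, (walkPlus_eq_and_walkMinus_eq K w).2]
  have hpath : ∀ {u v : V} (w : G.Walk u v), pathBinomial K w =
      monomial (single (Sum.inl u) 1 + plusExp w) 1 -
        monomial (single (Sum.inl v) 1 + minusExp w) 1 := fun w => by
    rw [pathBinomial, (walkPlus_eq_and_walkMinus_eq K w).1, (walkPlus_eq_and_walkMinus_eq K w).2,
      vertexVar, vertexVar, X, X, monomial_mul, monomial_mul, one_mul]
  have hpair : ∀ {u₀ u₁ v₀ v₁ : V} (w₁ : G.Walk u₀ u₁) (w₂ : G.Walk v₀ v₁),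
      pathPairBinomial K w₁ w₂ =
      monomial (single (Sum.inl u₀) 1 + single (Sum.inl u₁) 1 + (plusExp w₁ + minusExp w₂)) 1 -
        monomial (single (Sum.inl v₀) 1 + single (Sum.inl v₁) 1 + (minusExp w₁ + plusExp w₂)) 1 :=
    fun w₁ w₂ => by
      simp only [pathPairBinomial, walkPlus_eq_and_walkMinus_eq, vertexVar, X, monomial_mul,
        one_mul]
  constructor
  · rintro ⟨c, d, h, rfl⟩
    cases h with
    | @cycle v w hw he => exact .inl (.inl ⟨v, w, hw, he, (hcycle w).symm⟩)
    | @path u v w hw he h0 => exact .inl (.inr ⟨u, v, w, hw, he, h0, (hpath w).symm⟩)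
    | @pair u₀ u₁ v₀ v₁ w₁ w₂ h₁ o₁ h₂ o₂ hd =>
      exact .inr ⟨u₀, u₁, v₀, v₁, w₁, w₂, h₁, o₁, h₂, o₂, hd, (hpair w₁ w₂).symm⟩
  · rintro ((⟨v, w, hw, he, rfl⟩ | ⟨u, v, w, hw, he, h0, rfl⟩) |
      ⟨u₀, u₁, v₀, v₁, w₁, w₂, h₁, o₁, h₂, o₂, hd, rfl⟩)
    · exact ⟨_, _, .cycle w hw he, hcycle w⟩
    · exact ⟨_, _, .path w hw he h0, hpath w⟩
    · exact ⟨_, _, .pair w₁ w₂ h₁ o₁ h₂ o₂ hd, hpair w₁ w₂⟩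

variable [Finite V]

/-- Take a walk pair `(c, d)` below `(a, b)`. As `b` is standard, `d` cannot be the larger term; so
`c` leads and minimality gives `c = a`. Then `b - d` has degree zero and vanishes. -/
theorem isWalkPair_of_isReducedBinomial (hG : G.IsBipartite)
    {m : MonomialOrder.{u, u} (V ⊕ G.edgeSet)} {a b : V ⊕ G.edgeSet →₀ ℕ}
    (h : IsReducedBinomial m (reesDegree G) a b) : IsWalkPair G a b := by
  have hne : a ≠ b := by
    rintro rfl
    exact h.lt.false
  obtain ⟨hv, he⟩ := Prod.ext_iff.1 h.map_eq
  obtain ⟨c, d, hcd, hc, hd⟩ := hasWalkPairLE_of_ne hG hv.symm he.symm hne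
  have hπ := hcd.reesDegree_eq
  rcases lt_or_gt_of_ne fun h => hcd.ne (m.toSyn.injective h) with hlt | hlt
  · exact absurd (Nonstandard.mono ⟨c, hπ, hlt⟩ hd) h.standard
  · obtain rfl := h.minimal c ⟨d, hπ.symm, hlt⟩ hc
    obtain ⟨e, rfl⟩ := exists_add_of_le hd
    have h1 := h.map_eq
    rw [map_add, hπ] at h1
    have he0 : e = 0 := eq_zero_of_vertexDegree_eq_zero (congrArg Prod.fst (add_eq_left.1 h1))
    rwa [he0, add_zero]

/-- The order eliminates all variables outside the binomial and takes a variable `i₀` of `c` as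
largest inside. Smaller monomials in a fibre then stay in the support, where the circuit property
describes the whole fibre. -/
theorem IsWalkPair.exists_isReducedBinomial {c d : V ⊕ G.edgeSet →₀ ℕ} (h : IsWalkPair G c d) :
    ∃ m : MonomialOrder.{u, u} (V ⊕ G.edgeSet), IsReducedBinomial m (reesDegree G) c d := by
  obtain ⟨i₀, hi₀⟩ := Finsupp.ne_iff.1 h.left_ne_zero
  rw [Finsupp.zero_apply] at hi₀
  have hd₀ := (h.disjoint i₀).resolve_left hi₀
  obtain ⟨m, helim, hlt⟩ := exists_eliminationOrder {i | c i ≠ 0 ∨ d i ≠ 0} i₀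
  have hS : ∀ {a : V ⊕ G.edgeSet →₀ ℕ},
      (∀ i ∉ {i | c i ≠ 0 ∨ d i ≠ 0}, a i = 0) ↔ ∀ i, c i = 0 → d i = 0 → a i = 0 := by
    intro a
    refine forall_congr' fun i => ?_
    simp only [Set.mem_ofPred_eq, not_or, not_not, and_imp]
  have hdc : d ≺[m] c := hlt c d (hS.2 fun i hc _ => hc) (hS.2 fun i _ hd => hd) (by omega)
  /- In the variables of the binomial, a nonstandard exponent is a multiple of `c - d` above
  another one of its fibre. -/
  have key : ∀ a b : V ⊕ G.edgeSet →₀ ℕ, (∀ i, c i = 0 → d i = 0 → a i = 0) →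
      reesDegree G b = reesDegree G a → b ≺[m] a → ∃ n : ℕ, 0 < n ∧ a + n • d = b + n • c := by
    intro a b ha hπ hba
    have hb := hS.1 (helim a b hba (hS.2 ha))
    obtain ⟨hv, he⟩ := Prod.ext_iff.1 hπ
    obtain ⟨k, hk⟩ := h.exists_sub_eq ha hb hv.symm he.symm
    -- A multiple `k ≤ 0` would give `a + n • c = b + n • d`, against `b ≺[m] a` and `d ≺[m] c`.
    rcases lt_or_ge 0 k with hpos | hneg
    · obtain ⟨n, rfl⟩ := Int.eq_ofNat_of_zero_le hpos.le
      refine ⟨n, by exact_mod_cast hpos, ?_⟩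
      ext i
      have := hk i
      simp only [Finsupp.add_apply, Finsupp.smul_apply, smul_eq_mul]
      zify
      linarith
    · obtain ⟨n, hn⟩ := Int.eq_ofNat_of_zero_le (neg_nonneg.2 hneg)
      have hab : a + n • c = b + n • d := by
        ext i
        have := hk i
        rw [← neg_neg k, hn] at this
        simp only [Finsupp.add_apply, Finsupp.smul_apply, smul_eq_mul]
        zify
        linarith
      have h1 := congrArg m.toSyn hab
      rw [map_add, map_add, map_nsmul, map_nsmul] at h1
      have h2 : n • m.toSyn d ≤ n • m.toSyn c := nsmul_le_nsmul_right hdc.le n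
      exact absurd h1 (add_lt_add_of_lt_of_le hba h2).ne'
  -- On the support of `c` the exponent `d` vanishes, leaving `a i = b i + n * c i` with `n`
  -- positive.
  have hcle : ∀ {a b : V ⊕ G.edgeSet →₀ ℕ} {n : ℕ}, 0 < n → a + n • d = b + n • c → c ≤ a := by
    intro a b n hn hab i
    rcases h.disjoint i with hi | hi
    · rw [hi]; exact Nat.zero_le _
    · have := DFunLike.congr_fun hab i
      simp only [Finsupp.add_apply, Finsupp.smul_apply, smul_eq_mul, hi, mul_zero, add_zero] at this
      rw [this]
      exact (Nat.le_mul_of_pos_left _ hn).trans (Nat.le_add_left _ _)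
  refine ⟨m, h.reesDegree_eq.symm, hdc, ?_, ?_⟩
  -- If `d` were nonstandard, then `c ≤ d`, which fails at `i₀`.
  · rintro ⟨b, hb, hlt⟩
    obtain ⟨n, hn, hdb⟩ := key d b (fun i _ hd => hd) hb hlt
    have := hcle hn hdb i₀
    omega
  · rintro s ⟨b, hb, hlt⟩ hsc
    obtain ⟨n, hn, hsb⟩ := key s b
      (fun i hc _ => Nat.eq_zero_of_le_zero (hc ▸ hsc i)) hb hlt
    exact le_antisymm hsc (hcle hn hsb)

end Main

end BipartiteRees

theorem theoremA {V : Type*} [Finite V] (K : Type*) [Field K]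
    (G : SimpleGraph V) (hG : G.IsBipartite) :
    BipartiteRees.universalGroebnerBasis (BipartiteRees.reesIdeal K G) =
      {f | ∃ (v : V) (w : G.Walk v v), w.IsCycle ∧ Even w.length ∧
          f = BipartiteRees.cycleBinomial K w} ∪
      {f | ∃ (v₀ vₐ : V) (w : G.Walk v₀ vₐ), w.IsPath ∧ Even w.length ∧ 0 < w.length ∧
          f = BipartiteRees.pathBinomial K w} ∪
      {f | ∃ (u₀ uₐ v₀ v_b : V) (w₁ : G.Walk u₀ uₐ) (w₂ : G.Walk v₀ v_b),
          w₁.IsPath ∧ Odd w₁.length ∧ w₂.IsPath ∧ Odd w₂.length ∧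
          w₁.support.Disjoint w₂.support ∧
          f = BipartiteRees.pathPairBinomial K w₁ w₂} := by
  ext f
  rw [← BipartiteRees.exists_isWalkPair_iff]
  constructor
  · rintro ⟨m, B, hB, hf⟩
    obtain ⟨a, b, hab, rfl⟩ := (BipartiteRees.isToric_reesIdeal K).exists_eq_binomial hB hf
    exact ⟨a, b, BipartiteRees.isWalkPair_of_isReducedBinomial hG hab, rfl⟩
  · rintro ⟨c, d, hcd, rfl⟩
    obtain ⟨m, hm⟩ := hcd.exists_isReducedBinomial
    obtain ⟨B, hB, hmem⟩ :=
      (BipartiteRees.isToric_reesIdeal (G := G) K).exists_isReducedGroebnerBasis m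
    exact ⟨m, B, hB, hmem c d hm⟩
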